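/- Let $f:(0,\infty)\to(0,1]$ be non-increasing with $f(x)\to 0$ as $x\to\infty$, and regularly varying at infinity with index $-\gamma$, where $\gamma\in[0,1)$; that is, $\lim_{x\to\infty} f(ax)/f(x)=a^{-\gamma}$ for every $a>0$. For a finite multigraph $G$ with at least one edge let $\pi_G(v)=\deg(v)/\sum_w\deg(w)$ (a loop contributes $2$ to the degree of its vertex). Let $G_0$ be the multigraph with one vertex and one loop. Given $G_t=G_t(f)$, the multigraph $G_{t+1}$ is obtained, independently of the past, as follows: with probability $f(t+1)$ a new vertex is added and joined by an edge to a vertex of $G_t$ chosen according to $\pi_{G_t}$; with probability $1-f(t+1)$ a new edge is added between two vertices of $G_t$ (possibly equal, or already adjacent) chosen independently according to $\pi_{G_t}$. Let $\omega_t$ be the clique number of $G_t(f)$, i.e. the largest number of pairwise adjacent vertices (loops and multiplicities are ignored). Then for every $\delta\in(0,1)$ there are constants $c_1,c_2,c_3>0$ depending on $\delta$ only such that, for every $\gamma$ and $f$ as above, $$ \mathbb{P}\left(c_1t^{(1-\gamma)(1-\delta)/2}\le\omega_t\le c_2t^{(1-\gamma)(1+\delta)/2}\right)\ge 1-\frac{c_3}{\log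 t} $$ for all integers $t\ge t_0$, where $t_0$ may depend on $\delta$, $\gamma$ and $f$. Moreover, with the same $c_1$ and $c_2$, the inequality holds for all integers $t\ge 2$ if $c_3$ is replaced by a positive constant $C_3$ that may depend on $\delta$, $\gamma$ and $f$. -/

import Mathlib

open scoped ENNReal Topology

/-- A finite multigraph (loops and multiple edges allowed) with at least one edge. The vertices are
`0, …, order - 1`, and `edges` is the multiset of edges, a loop at `v` being `s(v, v)`. -/
structure Multigraph where
  order : ℕ
  edges : Multiset (Sym2 ℕ)
  lt_order : ∀ e ∈ edges, ∀ v ∈ e, v < order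
  edges_ne_zero : edges ≠ 0

namespace Multigraph

/-- The events of a random multigraph are all sets of multigraphs. -/
instance : MeasurableSpace Multigraph := ⊤

/-- The degree of `v`: the number of edge ends at `v`, so that a loop counts twice. -/
noncomputable def degree (G : Multigraph) (v : ℕ) : ℕ :=
  (G.edges.map fun e => e.toMultiset.count v).sum

theorem degree_ne_zero (G : Multigraph) {e : Sym2 ℕ} (he : e ∈ G.edges) {v : ℕ} (hv : v ∈ e) :
    G.degree v ≠ 0 := by
  intro h
  rw [degree, Multiset.sum_eq_zero_iff] at h
  have h0 := h _ (Multiset.mem_map_of_mem (fun e : Sym2 ℕ => e.toMultiset.count v) he)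
  exact Multiset.count_ne_zero.mpr (Sym2.mem_toMultiset.mpr hv) h0

/-- The sum of the degrees of all vertices. -/
noncomputable def totalDegree (G : Multigraph) : ℕ := ∑ w : Fin G.order, G.degree w

theorem totalDegree_ne_zero (G : Multigraph) : G.totalDegree ≠ 0 := by
  obtain ⟨e, he⟩ := Multiset.exists_mem_of_ne_zero G.edges_ne_zero
  obtain ⟨v, hv⟩ : ∃ v, v ∈ e := ⟨_, Sym2.out_fst_mem e⟩
  intro h
  rw [totalDegree, Finset.sum_eq_zero_iff] at h
  exact G.degree_ne_zero he hv (h ⟨v, G.lt_order e he v hv⟩ (Finset.mem_univ _))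

/-- The preferential attachment distribution `π_G(v) = degree v / ∑ w, degree w` on the vertices. -/
noncomputable def prefAttach (G : Multigraph) : PMF (Fin G.order) :=
  PMF.ofFintype (fun v => (G.degree v : ℝ≥0∞) / (G.totalDegree : ℝ≥0∞)) (by
    simp_rw [div_eq_mul_inv]
    rw [← Finset.sum_mul, ← Nat.cast_sum]
    exact ENNReal.mul_inv_cancel (Nat.cast_ne_zero.mpr G.totalDegree_ne_zero)
      (ENNReal.natCast_ne_top _))

/-- Add a new vertex (with label `G.order`) and connect it to the vertex `u`. -/
def addVertex (G : Multigraph) (u : Fin G.order) : Multigraph where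
  order := G.order + 1
  edges := s((u : ℕ), G.order) ::ₘ G.edges
  lt_order := by
    intro e he v hv
    rcases Multiset.mem_cons.mp he with rfl | he
    · rcases Sym2.mem_iff.mp hv with rfl | rfl <;> omega
    · exact Nat.lt_succ_of_lt (G.lt_order e he v hv)
  edges_ne_zero := Multiset.cons_ne_zero

/-- Add a new edge between the vertices `u` and `v` (a loop if `u = v`). -/
def addEdge (G : Multigraph) (u v : Fin G.order) : Multigraph where
  order := G.order
  edges := s((u : ℕ), (v : ℕ)) ::ₘ G.edges
  lt_order := by
    intro e he w hw
    rcases Multiset.mem_cons.mp he with rfl | he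
    · rcases Sym2.mem_iff.mp hw with rfl | rfl <;> omega
    · exact G.lt_order e he w hw
  edges_ne_zero := Multiset.cons_ne_zero

/-- The multigraph with one vertex and one loop attached to it. -/
def loop : Multigraph where
  order := 1
  edges := {s(0, 0)}
  lt_order := by
    intro e he v hv
    rw [Multiset.mem_singleton.mp he] at hv
    rcases Sym2.mem_iff.mp hv with rfl | rfl <;> omega
  edges_ne_zero := Multiset.singleton_ne_zero _

/-- The simple graph obtained by removing loops and merging multiple edges. -/
def simplification (G : Multigraph) : SimpleGraph (Fin G.order) where
  Adj u v := u ≠ v ∧ s((u : ℕ), (v : ℕ)) ∈ G.edges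
  symm := ⟨fun _ _ h => ⟨h.1.symm, Sym2.eq_swap ▸ h.2⟩⟩
  loopless := ⟨fun _ h => h.1 rfl⟩

/-- The clique number: the largest number of pairwise adjacent vertices. -/
noncomputable def cliqueNumber (G : Multigraph) : ℕ := G.simplification.cliqueNum

end Multigraph

/-- A coin that shows `true` with probability `p` and `false` with probability `1 - p`. -/
noncomputable def coin (p : unitInterval) : PMF Bool :=
  PMF.ofFintype (fun b => ENNReal.ofReal (if b then (p : ℝ) else 1 - p)) (by
    rw [Fintype.sum_bool, ← ENNReal.ofReal_add (by simpa using p.2.1) (by simpa using p.2.2)]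
    simp)

/-- One step from `G`: with probability `p` a vertex-operation (a new vertex is attached to a vertex
with law `π_G`), otherwise an edge-operation (a new edge joins two vertices chosen independently
with law `π_G`). -/
noncomputable def stepLaw (p : unitInterval) (G : Multigraph) : PMF Multigraph :=
  (coin p).bind fun z =>
    if z then G.prefAttach.bind fun u => PMF.pure (G.addVertex u)
    else G.prefAttach.bind fun u => G.prefAttach.bind fun v => PMF.pure (G.addEdge u v)

/-- The law of `G_t(f)`: start from one vertex with a loop, and obtain `G_{t+1}` from `G_t` by a
step whose vertex-operation probability is `f (t + 1)`. -/
noncomputable def graphLaw (f : ℝ → unitInterval) : ℕ → PMF Multigraph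
  | 0 => PMF.pure Multigraph.loop
  | t + 1 => (graphLaw f t).bind (stepLaw (f ((t : ℝ) + 1)))

/-- `g` is positive on `(0, ∞)` and regularly varying at infinity with index `ρ`. Only the values
on `(0, ∞)` matter. -/
def IsRegularlyVarying (g : ℝ → ℝ) (ρ : ℝ) : Prop :=
  (∀ x : ℝ, 0 < x → 0 < g x) ∧
    ∀ a : ℝ, 0 < a → Filter.Tendsto (fun x : ℝ => g (a * x) / g x) Filter.atTop (𝓝 (a ^ ρ))

/-- `g` is monotonically decreasing (in the weak sense) on `(0, ∞)` and tends to zero at infinity. -/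
def DecreasesToZero (g : ℝ → ℝ) : Prop :=
  AntitoneOn g (Set.Ioi 0) ∧ Filter.Tendsto g Filter.atTop (𝓝 0)

/-- The probability that `A ≤ ω_t ≤ B`, where `ω_t` is the clique number of `G_t(f)`. -/
noncomputable def probCliqueBetween (f : ℝ → unitInterval) (t : ℕ) (A B : ℝ) : ℝ :=
  (graphLaw f t).toMeasure.real
    {G : Multigraph | A ≤ (G.cliqueNumber : ℝ) ∧ (G.cliqueNumber : ℝ) ≤ B}

/-! Each step adds two edge ends, so the total degree at time `t` is exactly `2(t+1)`. Everything
reduces to explicit recursions for means, with `evolve` as the expectation operator. Each tail of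
the clique number comes from splitting time.

Upper tail. At time `s ≈ √t` Markov's inequality for the order gives at most `m` vertices, with `m`
slightly above `t^((1-γ)/2)`. Labels from `m` on are then born later, when vertex-operations have
probability at most `φ = f(s+1)`. Their total degree is of order `φ t` up to logarithms in first and
second moment, so an edge-operation joins two of them with probability about `φ²`, and at most `t φ²
≈ t^(1-γ)` such edges are expected (`evolve_lateEdges_le`). A clique of size `B` uses at least
`(B-m)²/4` of them, so `B` just above `t^((1-γ)/2)` is unlikely (`evolve_largeClique_le`).

Lower tail. At a time `s` slightly below `√t`, there are at least `m ≈ t^((1-γ)(1-δ)/2)` vertices by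
a Chernoff bound. By time `t/2` most of the first `m` have degree at least `L = t^(1/2+ε)`: the
function `birthWeight`, of order `d^(-1/2)`, has a mean that decays almost like `(s/t)^(1/2)`
(`evolve_birthWeight_le`). In the second half of the time each edge-operation joins a given pair of
these hubs with probability at least `(L/2t)²`, so by a union bound they all become adjacent
(`evolve_nonadj_le`, `evolve_smallClique_le`).

All error terms are at most a negative power of `t`, so `1/log t` is generous. The calculus of
`HasExponent` turns these comparisons into strict inequalities between exponents. -/

namespace Multigraph

/-! ### Degrees under the two operations -/

theorem count_toMultiset_mk (a b v : ℕ) :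
    (s(a, b) : Sym2 ℕ).toMultiset.count v = (if v = a then 1 else 0) + (if v = b then 1 else 0) := by
  change Multiset.count v ({a, b} : Multiset ℕ) = _
  rw [Multiset.insert_eq_cons, Multiset.count_cons, Multiset.count_singleton, add_comm]

theorem degree_addVertex (G : Multigraph) (u : Fin G.order) (v : ℕ) :
    (G.addVertex u).degree v =
      G.degree v + ((if v = u then 1 else 0) + (if v = G.order then 1 else 0)) := by
  simp only [degree, addVertex, Multiset.map_cons, Multiset.sum_cons, count_toMultiset_mk]
  ring

theorem degree_addEdge (G : Multigraph) (u w : Fin G.order) (v : ℕ) :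
    (G.addEdge u w).degree v =
      G.degree v + ((if v = u then 1 else 0) + (if v = w then 1 else 0)) := by
  simp only [degree, addEdge, Multiset.map_cons, Multiset.sum_cons, count_toMultiset_mk]
  ring

theorem degree_eq_zero_of_le (G : Multigraph) {v : ℕ} (hv : G.order ≤ v) : G.degree v = 0 := by
  rw [degree, Multiset.sum_eq_zero_iff]
  intro x hx
  obtain ⟨e, he, rfl⟩ := Multiset.mem_map.mp hx
  rw [Multiset.count_eq_zero, Sym2.mem_toMultiset]
  exact fun h => absurd (G.lt_order e he v h) (by omega)

/-- The sum of the degrees of the vertices, weighted by `φ`. -/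
noncomputable def weightedDegree (G : Multigraph) (φ : ℕ → ℝ) : ℝ :=
  ∑ v : Fin G.order, (G.degree v : ℝ) * φ v

theorem weightedDegree_one (G : Multigraph) :
    G.weightedDegree (fun _ => 1) = G.totalDegree := by
  simp [weightedDegree, totalDegree]

theorem weightedDegree_addVertex (G : Multigraph) (u : Fin G.order) (φ : ℕ → ℝ) :
    (G.addVertex u).weightedDegree φ = G.weightedDegree φ + (φ u + φ G.order) := by
  unfold weightedDegree
  change ∑ v : Fin (G.order + 1), _ = _
  rw [Fin.sum_univ_castSucc]
  have h1 : ∀ v : Fin G.order, ((v : ℕ) = G.order) = False := fun v => by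
    simpa using v.2.ne
  have h2 : (G.order = (u : ℕ)) = False := by simpa using u.2.ne'
  simp only [degree_addVertex, Fin.val_castSucc, Fin.val_last, h1, h2, if_true, if_false,
    Fin.val_inj, G.degree_eq_zero_of_le le_rfl]
  push_cast
  simp only [add_mul, Finset.sum_add_distrib, ite_mul, zero_mul, one_mul, add_zero,
    Finset.sum_ite_eq', Finset.mem_univ, if_true]
  ring

theorem weightedDegree_addEdge (G : Multigraph) (u w : Fin G.order) (φ : ℕ → ℝ) :
    (G.addEdge u w).weightedDegree φ = G.weightedDegree φ + (φ u + φ w) := by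
  unfold weightedDegree
  change ∑ v : Fin G.order, _ = _
  simp only [degree_addEdge, Fin.val_inj]
  push_cast
  simp only [add_mul, Finset.sum_add_distrib, ite_mul, zero_mul, one_mul,
    Finset.sum_ite_eq', Finset.mem_univ, if_true]

/-- The graphs that are possible at time `t`, as far as degrees are concerned. -/
structure Reachable (t : ℕ) (G : Multigraph) : Prop where
  totalDegree_eq : (G.totalDegree : ℝ) = 2 * (t + 1)
  one_le_degree : ∀ v < G.order, 1 ≤ G.degree v

theorem Reachable.loop : Reachable 0 loop := by
  have h : ∀ v : ℕ, Multigraph.loop.degree v = if v = 0 then 2 else 0 := fun v => by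
    simp only [degree, Multigraph.loop, Multiset.map_singleton, Multiset.sum_singleton,
      count_toMultiset_mk]
    split_ifs <;> rfl
  constructor
  · rw [totalDegree]
    change ((∑ w : Fin 1, _ : ℕ) : ℝ) = _
    simp [h]
  · intro v hv
    have : v = 0 := Nat.lt_one_iff.mp hv
    simp [h, this]

theorem Reachable.addVertex {t : ℕ} {G : Multigraph} (h : Reachable t G) (u : Fin G.order) :
    Reachable (t + 1) (G.addVertex u) := by
  constructor
  · rw [← weightedDegree_one, weightedDegree_addVertex, weightedDegree_one, h.totalDegree_eq]
    push_cast
    ring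
  · intro v hv
    rw [degree_addVertex]
    rcases Nat.lt_succ_iff_lt_or_eq.mp hv with hv | rfl
    · have := h.one_le_degree v hv
      omega
    · simp; omega

theorem Reachable.addEdge {t : ℕ} {G : Multigraph} (h : Reachable t G) (u w : Fin G.order) :
    Reachable (t + 1) (G.addEdge u w) := by
  constructor
  · rw [← weightedDegree_one, weightedDegree_addEdge, weightedDegree_one, h.totalDegree_eq]
    push_cast
    ring
  · intro v hv
    rw [degree_addEdge]
    have := h.one_le_degree v hv
    omega

/-! ### Means over one step and over several steps -/

/-- The mean of `φ` under the preferential attachment distribution. -/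
noncomputable def attachMean (G : Multigraph) (φ : Fin G.order → ℝ) : ℝ :=
  ∑ u : Fin G.order, (G.degree u : ℝ) / G.totalDegree * φ u

theorem attachMean_mono (G : Multigraph) {φ ψ : Fin G.order → ℝ} (h : ∀ u, φ u ≤ ψ u) :
    G.attachMean φ ≤ G.attachMean ψ :=
  Finset.sum_le_sum fun u _ => mul_le_mul_of_nonneg_left (h u) (by positivity)

theorem attachMean_nonneg (G : Multigraph) {φ : Fin G.order → ℝ} (h : ∀ u, 0 ≤ φ u) :
    0 ≤ G.attachMean φ :=
  Finset.sum_nonneg fun u _ => mul_nonneg (by positivity) (h u)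

theorem attachMean_add (G : Multigraph) (φ ψ : Fin G.order → ℝ) :
    G.attachMean (fun u => φ u + ψ u) = G.attachMean φ + G.attachMean ψ := by
  simp [attachMean, mul_add, Finset.sum_add_distrib]

theorem attachMean_const_mul (G : Multigraph) (c : ℝ) (φ : Fin G.order → ℝ) :
    G.attachMean (fun u => c * φ u) = c * G.attachMean φ := by
  simp only [attachMean, Finset.mul_sum]
  exact Finset.sum_congr rfl fun u _ => by ring

theorem attachMean_const (G : Multigraph) (c : ℝ) : G.attachMean (fun _ => c) = c := by
  have h : (G.totalDegree : ℝ) ≠ 0 := Nat.cast_ne_zero.mpr G.totalDegree_ne_zero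
  rw [attachMean, ← Finset.sum_mul, ← Finset.sum_div, ← Nat.cast_sum]
  change (G.totalDegree : ℝ) / _ * _ = _
  rw [div_self h, one_mul]

theorem attachMean_eq_weightedDegree (G : Multigraph) (φ : ℕ → ℝ) :
    G.attachMean (fun u => φ u) = G.weightedDegree φ / G.totalDegree := by
  simp only [attachMean, weightedDegree, Finset.sum_div]
  exact Finset.sum_congr rfl fun u _ => by ring

theorem attachMean_ite_eq (G : Multigraph) {v : ℕ} (hv : v < G.order) :
    G.attachMean (fun u => if (u : ℕ) = v then 1 else 0) = G.degree v / G.totalDegree := by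
  have h : ∀ u : Fin G.order, ((u : ℕ) = v) = (u = ⟨v, hv⟩) := fun u => by
    rw [Fin.ext_iff]
  simp [attachMean, h]

/-- The mean of `g` after one step from `G` with vertex-operation probability `p`. -/
noncomputable def stepMean (p : unitInterval) (g : Multigraph → ℝ) (G : Multigraph) : ℝ :=
  p * G.attachMean (fun u => g (G.addVertex u)) +
    (1 - p) * G.attachMean (fun u => G.attachMean fun w => g (G.addEdge u w))

/-- A property of graphs at given times that no step can destroy. -/
def Persistent (P : ℕ → Multigraph → Prop) : Prop :=
  ∀ t G, P t G → (∀ u, P (t + 1) (G.addVertex u)) ∧ ∀ u w, P (t + 1) (G.addEdge u w)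

theorem persistent_reachable : Persistent Reachable :=
  fun _ _ h => ⟨h.addVertex, h.addEdge⟩

theorem Persistent.and {P Q : ℕ → Multigraph → Prop} (hP : Persistent P) (hQ : Persistent Q) :
    Persistent fun t G => P t G ∧ Q t G :=
  fun t G h => ⟨fun u => ⟨(hP t G h.1).1 u, (hQ t G h.2).1 u⟩,
    fun u w => ⟨(hP t G h.1).2 u w, (hQ t G h.2).2 u w⟩⟩

theorem persistent_degree (L : ℝ) (v : ℕ) : Persistent fun _ G => L ≤ G.degree v := by
  intro t G h
  refine ⟨fun u => h.trans ?_, fun u w => h.trans ?_⟩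
  · rw [degree_addVertex]
    exact_mod_cast Nat.le_add_right _ _
  · rw [degree_addEdge]
    exact_mod_cast Nat.le_add_right _ _

theorem persistent_lt_order (v : ℕ) : Persistent fun _ G => v < G.order :=
  fun _ _ h => ⟨fun _ => Nat.lt_succ_of_lt h, fun _ _ => h⟩

theorem stepMean_mono {P : ℕ → Multigraph → Prop} (hP : Persistent P) {t : ℕ} {G : Multigraph}
    (hG : P t G) (p : unitInterval) {g g' : Multigraph → ℝ} (h : ∀ H, P (t + 1) H → g H ≤ g' H) :
    stepMean p g G ≤ stepMean p g' G := by
  have hp := p.2.1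
  have hp' : (0 : ℝ) ≤ 1 - p := sub_nonneg.mpr p.2.2
  exact add_le_add
    (mul_le_mul_of_nonneg_left (G.attachMean_mono fun u => h _ ((hP t G hG).1 u)) hp)
    (mul_le_mul_of_nonneg_left (G.attachMean_mono fun u => G.attachMean_mono fun w =>
      h _ ((hP t G hG).2 u w)) hp')

theorem stepMean_add (p : unitInterval) (g g' : Multigraph → ℝ) (G : Multigraph) :
    stepMean p (fun H => g H + g' H) G = stepMean p g G + stepMean p g' G := by
  simp only [stepMean, attachMean_add]
  ring

theorem stepMean_const_mul (p : unitInterval) (c : ℝ) (g : Multigraph → ℝ) (G : Multigraph) :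
    stepMean p (fun H => c * g H) G = c * stepMean p g G := by
  simp only [stepMean, attachMean_const_mul]
  ring

theorem stepMean_const (p : unitInterval) (c : ℝ) (G : Multigraph) :
    stepMean p (fun _ => c) G = c := by
  simp only [stepMean, attachMean_const]
  ring

/-- The mean of `g` after `n` steps from a graph at time `s`, where the step from time `t` to time
`t + 1` is a vertex-operation with probability `p t`. -/
noncomputable def evolve (p : ℕ → unitInterval) (s : ℕ) :
    ℕ → (Multigraph → ℝ) → Multigraph → ℝ
  | 0, g => g
  | n + 1, g => evolve p s n (stepMean (p (s + n)) g)

section evolve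

variable (p : ℕ → unitInterval) (s : ℕ)

theorem evolve_mono {P : ℕ → Multigraph → Prop} (hP : Persistent P) {G : Multigraph}
    (hG : P s G) (n : ℕ) {g g' : Multigraph → ℝ} (h : ∀ H, P (s + n) H → g H ≤ g' H) :
    evolve p s n g G ≤ evolve p s n g' G := by
  induction n generalizing g g' with
  | zero => exact h G hG
  | succ n ih => exact ih fun H hH => stepMean_mono hP hH _ h

theorem evolve_add (n : ℕ) (g g' : Multigraph → ℝ) (G : Multigraph) :
    evolve p s n (fun H => g H + g' H) G = evolve p s n g G + evolve p s n g' G := by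
  induction n generalizing g g' with
  | zero => rfl
  | succ n ih =>
    simp only [evolve, ← ih]
    congr 1
    exact funext fun H => stepMean_add _ _ _ _

theorem evolve_const_mul (n : ℕ) (c : ℝ) (g : Multigraph → ℝ) (G : Multigraph) :
    evolve p s n (fun H => c * g H) G = c * evolve p s n g G := by
  induction n generalizing g with
  | zero => rfl
  | succ n ih =>
    simp only [evolve, ← ih]
    congr 1
    exact funext fun H => stepMean_const_mul _ _ _ _

theorem evolve_const (n : ℕ) (c : ℝ) (G : Multigraph) : evolve p s n (fun _ => c) G = c := by
  induction n with
  | zero => rfl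
  | succ n ih =>
    simp only [evolve]
    rw [show stepMean (p (s + n)) (fun _ => c) = fun _ => c from
      funext fun H => stepMean_const _ _ _]
    exact ih

theorem evolve_sum {ι : Type*} (I : Finset ι) (n : ℕ) (g : ι → Multigraph → ℝ) (G : Multigraph) :
    evolve p s n (fun H => ∑ i ∈ I, g i H) G = ∑ i ∈ I, evolve p s n (g i) G := by
  classical
  induction I using Finset.induction_on with
  | empty => simpa using evolve_const p s n 0 G
  | insert i I hi ih =>
    simp only [Finset.sum_insert hi]
    rw [evolve_add, ih]

theorem evolve_comp (n k : ℕ) (g : Multigraph → ℝ) (G : Multigraph) :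
    evolve p s (n + k) g G = evolve p s n (evolve p (s + n) k g) G := by
  induction k generalizing g with
  | zero => rfl
  | succ k ih =>
    change evolve p s (n + k) (stepMean (p (s + (n + k))) g) G = _
    rw [ih, ← add_assoc]
    rfl

theorem evolve_nonneg (n : ℕ) {g : Multigraph → ℝ} (h : ∀ H, 0 ≤ g H) (G : Multigraph) :
    0 ≤ evolve p s n g G := by
  rw [← evolve_const p s n 0 G]
  exact evolve_mono p s (P := fun _ _ => True) (fun _ _ _ => ⟨fun _ => trivial, fun _ _ => trivial⟩)
    trivial n fun H _ => h H

/-- `evolve` averages out the last step first, so this is conditioning on the graph at time `s + n`.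
The moment recursions below rest on it. -/
theorem evolve_succ_le {P : ℕ → Multigraph → Prop} (hP : Persistent P) {G : Multigraph}
    (hG : P s G) (n : ℕ) {g g' : Multigraph → ℝ}
    (h : ∀ H, P (s + n) H → stepMean (p (s + n)) g H ≤ g' H) :
    evolve p s (n + 1) g G ≤ evolve p s n g' G :=
  evolve_mono p s hP hG n h

end evolve

/-! ### Passage from the law of the process to `evolve` -/

theorem tsum_bind_mul {α β : Type*} (q : PMF α) (k : α → PMF β) (g : β → ℝ≥0∞) :
    ∑' y, q.bind k y * g y = ∑' x, q x * ∑' y, k x y * g y := by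
  simp only [PMF.bind_apply, ← ENNReal.tsum_mul_right, ← ENNReal.tsum_mul_left]
  rw [ENNReal.tsum_comm]
  simp only [mul_assoc]

theorem tsum_pure_mul {α : Type*} (x : α) (g : α → ℝ≥0∞) :
    ∑' y, PMF.pure x y * g y = g x := by
  rw [tsum_eq_single x fun y hy => by simp [PMF.pure_apply, hy]]
  simp

theorem tsum_prefAttach_mul (G : Multigraph) {φ : Fin G.order → ℝ} (h : ∀ u, 0 ≤ φ u) :
    ∑' u, G.prefAttach u * ENNReal.ofReal (φ u) = ENNReal.ofReal (G.attachMean φ) := by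
  rw [tsum_fintype, attachMean, ENNReal.ofReal_sum_of_nonneg fun u _ =>
    mul_nonneg (by positivity) (h u)]
  refine Finset.sum_congr rfl fun u _ => ?_
  have hN : (0 : ℝ) < G.totalDegree := Nat.cast_pos.mpr (Nat.pos_of_ne_zero G.totalDegree_ne_zero)
  rw [ENNReal.ofReal_mul (by positivity), ENNReal.ofReal_div_of_pos hN, ENNReal.ofReal_natCast,
    ENNReal.ofReal_natCast]
  rfl

theorem tsum_stepLaw_mul (p : unitInterval) (G : Multigraph) {g : Multigraph → ℝ}
    (h : ∀ H, 0 ≤ g H) :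
    ∑' H, stepLaw p G H * ENNReal.ofReal (g H) = ENNReal.ofReal (stepMean p g G) := by
  have hp : (0 : ℝ) ≤ 1 - p := sub_nonneg.mpr p.2.2
  rw [stepLaw, tsum_bind_mul, tsum_fintype, Fintype.sum_bool, stepMean,
    ENNReal.ofReal_add (mul_nonneg p.2.1 (G.attachMean_nonneg fun _ => h _))
      (mul_nonneg hp (G.attachMean_nonneg fun _ => G.attachMean_nonneg fun _ => h _)),
    ENNReal.ofReal_mul p.2.1, ENNReal.ofReal_mul hp]
  simp only [if_true, Bool.false_eq_true, if_false, tsum_bind_mul, tsum_pure_mul]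
  rw [tsum_prefAttach_mul G fun u => h _]
  simp only [tsum_prefAttach_mul G fun u => h _]
  rw [tsum_prefAttach_mul G fun u => G.attachMean_nonneg fun _ => h _]
  simp [coin]

theorem stepMean_nonneg (p : unitInterval) {g : Multigraph → ℝ} (h : ∀ H, 0 ≤ g H)
    (G : Multigraph) : 0 ≤ stepMean p g G :=
  add_nonneg (mul_nonneg p.2.1 (G.attachMean_nonneg fun _ => h _))
    (mul_nonneg (sub_nonneg.mpr p.2.2)
      (G.attachMean_nonneg fun _ => G.attachMean_nonneg fun _ => h _))

theorem tsum_graphLaw_mul (f : ℝ → unitInterval) (t : ℕ) {g : Multigraph → ℝ}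
    (h : ∀ H, 0 ≤ g H) :
    ∑' H, graphLaw f t H * ENNReal.ofReal (g H) =
      ENNReal.ofReal (evolve (fun r => f ((r : ℝ) + 1)) 0 t g loop) := by
  induction t generalizing g with
  | zero => rw [graphLaw, tsum_pure_mul]; rfl
  | succ t ih =>
    rw [graphLaw, tsum_bind_mul]
    simp only [tsum_stepLaw_mul _ _ h]
    rw [ih (stepMean_nonneg _ h), evolve, zero_add]

open Classical in
theorem graphLaw_real (f : ℝ → unitInterval) (t : ℕ) (S : Set Multigraph) :
    (graphLaw f t).toMeasure.real S =
      evolve (fun r => f ((r : ℝ) + 1)) 0 t (fun H => if H ∈ S then 1 else 0) loop := by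
  have h : ∀ H : Multigraph, (0 : ℝ) ≤ if H ∈ S then 1 else 0 := fun H => by positivity
  rw [MeasureTheory.measureReal_def, PMF.toMeasure_apply _ MeasurableSpace.measurableSet_top,
    ← ENNReal.toReal_ofReal (evolve_nonneg _ 0 t h loop), ← tsum_graphLaw_mul f t h]
  congr 2
  ext H
  by_cases hH : H ∈ S <;> simp [hH]

theorem Reachable.totalDegree_pos {t : ℕ} {G : Multigraph} (h : Reachable t G) :
    (0 : ℝ) < G.totalDegree := by
  rw [h.totalDegree_eq]
  positivity

/-! ### Number of vertices -/

/-- The mean of a bilinear expression over the two ends of an edge-operation. -/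
theorem attachMean_attachMean_bilinear (G : Multigraph) (φ ψ : Fin G.order → ℝ) (a b c e : ℝ) :
    G.attachMean (fun u => G.attachMean fun w => a + b * φ u + c * ψ w + e * (φ u * ψ w)) =
      a + b * G.attachMean φ + c * G.attachMean ψ + e * (G.attachMean φ * G.attachMean ψ) := by
  have h : ∀ u, G.attachMean (fun w => a + b * φ u + c * ψ w + e * (φ u * ψ w)) =
      (a + c * G.attachMean ψ) + (b + e * G.attachMean ψ) * φ u := fun u => by
    rw [show (fun w => a + b * φ u + c * ψ w + e * (φ u * ψ w)) =
        fun w => (a + b * φ u) + (c + e * φ u) * ψ w from funext fun w => by ring,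
      attachMean_add, attachMean_const, attachMean_const_mul]
    ring
  simp only [h]
  rw [attachMean_add, attachMean_const, attachMean_const_mul]
  ring

theorem stepMean_of_order (p : unitInterval) (g : ℕ → ℝ) (G : Multigraph) :
    stepMean p (fun H => g H.order) G = p * g (G.order + 1) + (1 - p) * g G.order := by
  have h1 : ∀ u, (G.addVertex u).order = G.order + 1 := fun _ => rfl
  have h2 : ∀ u w, (G.addEdge u w).order = G.order := fun _ _ => rfl
  simp only [stepMean, h1, h2, attachMean_const]

theorem evolve_order (p : ℕ → unitInterval) (n : ℕ) :
    evolve p 0 n (fun H => H.order) loop = 1 + ∑ r ∈ Finset.range n, (p r : ℝ) := by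
  induction n with
  | zero => simp [evolve, loop]
  | succ n ih =>
    have h : stepMean (p (0 + n)) (fun H => (H.order : ℝ)) = fun H => H.order + (p n : ℝ) := by
      ext G
      rw [stepMean_of_order _ (fun k => (k : ℝ)), zero_add]
      push_cast
      ring
    rw [evolve, h, evolve_add, evolve_const, ih, Finset.sum_range_succ]
    ring

/-- Chernoff bound: a step multiplies the conditional mean of `2^(-order)` by `1 - p/2 ≤ exp(-q/2)`.
-/
theorem evolve_half_pow_order_le (p : ℕ → unitInterval) (q : ℝ) (n : ℕ)
    (hq : ∀ r < n, q ≤ p r) :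
    evolve p 0 n (fun H => (1 / 2 : ℝ) ^ H.order) loop ≤ Real.exp (-(q / 2)) ^ n := by
  induction n with
  | zero => simp [evolve, loop]; norm_num
  | succ n ih =>
    have h : ∀ G : Multigraph, stepMean (p (0 + n)) (fun H => (1 / 2 : ℝ) ^ H.order) G ≤
        Real.exp (-(q / 2)) * (1 / 2 : ℝ) ^ G.order := fun G => by
      rw [stepMean_of_order _ (fun k => (1 / 2 : ℝ) ^ k), zero_add]
      have h1 := Real.add_one_le_exp (-(q / 2))
      have h2 := hq n n.lt_succ_self
      calc _ = (1 - (p n : ℝ) / 2) * (1 / 2 : ℝ) ^ G.order := by rw [pow_succ]; ring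
        _ ≤ _ := by gcongr; linarith
    refine (evolve_succ_le p 0 persistent_reachable Reachable.loop n fun G _ => h G).trans ?_
    rw [evolve_const_mul, pow_succ']
    exact mul_le_mul_of_nonneg_left (ih fun r hr => hq r (hr.trans n.lt_succ_self))
      (Real.exp_nonneg _)

/-! ### Growth of the degree of a fixed vertex -/

/-- Up to a factor, the eigenfunction of eigenvalue `-1/2` of the pure birth process with rate `d`
at `d`. It is of order `d ^ (-1/2)`. -/
noncomputable def birthWeight (d : ℕ) : ℝ := ∏ j ∈ Finset.Ico 1 d, (1 - 1 / (2 * (j : ℝ)))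

theorem birthWeight_succ {d : ℕ} (hd : 1 ≤ d) :
    birthWeight (d + 1) = birthWeight d * (1 - 1 / (2 * (d : ℝ))) := by
  rw [birthWeight, Finset.prod_Ico_succ_top hd, birthWeight]

theorem one_le_cast {d : ℕ} (hd : 1 ≤ d) : (1 : ℝ) ≤ d := by exact_mod_cast hd

theorem birthWeight_pos (d : ℕ) : 0 < birthWeight d := by
  refine Finset.prod_pos fun j hj => ?_
  have hj' := one_le_cast (Finset.mem_Ico.mp hj).1
  rw [sub_pos, div_lt_one (by positivity)]
  linarith

theorem birthWeight_le_one (d : ℕ) : birthWeight d ≤ 1 := by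
  refine Finset.prod_le_one (fun j hj => ?_) fun j hj => ?_
  · have hj' := one_le_cast (Finset.mem_Ico.mp hj).1
    rw [sub_nonneg, div_le_one (by positivity)]
    linarith
  · have : (0 : ℝ) ≤ 1 / (2 * (j : ℝ)) := by positivity
    linarith

theorem birthWeight_succ_le {d : ℕ} (hd : 1 ≤ d) : birthWeight (d + 1) ≤ birthWeight d := by
  rw [birthWeight_succ hd]
  have : (0 : ℝ) ≤ 1 / (2 * (d : ℝ)) := by positivity
  exact mul_le_of_le_one_right (birthWeight_pos d).le (by linarith)

theorem one_le_four_mul_birthWeight_sq {d : ℕ} (hd : 1 ≤ d) :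
    1 ≤ 4 * d * birthWeight d ^ 2 := by
  rcases hd.eq_or_lt with rfl | hd2
  · norm_num [birthWeight]
  · clear hd
    -- With `d - 1` in place of `d` the right side is monotone: a step turns the factor `d - 1` into
    -- `d (1 - 1/(2d))² = d - 1 + 1/(4d)`. Equality holds at `d = 2`, where the induction starts.
    suffices h : 1 ≤ 4 * ((d : ℝ) - 1) * birthWeight d ^ 2 by
      nlinarith [sq_nonneg (birthWeight d)]
    induction d, hd2 using Nat.le_induction with
    | base => norm_num [birthWeight, Finset.prod_Ico_succ_top]
    | succ d hd ih =>
      have hd0 : (2 : ℝ) ≤ d := by exact_mod_cast hd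
      rw [birthWeight_succ (by omega)]
      refine ih.trans ?_
      push_cast
      rw [show 4 * ((d : ℝ) + 1 - 1) * (birthWeight d * (1 - 1 / (2 * d))) ^ 2 =
        4 * (d * (1 - 1 / (2 * (d : ℝ))) ^ 2) * birthWeight d ^ 2 by ring]
      gcongr
      have : (d : ℝ) * (1 - 1 / (2 * (d : ℝ))) ^ 2 = d - 1 + 1 / (4 * d) := by
        field_simp
        ring
      rw [this]
      have : (0 : ℝ) ≤ 1 / (4 * d) := by positivity
      linarith

/-- Prepares Markov's inequality: `2√L` times the weight dominates the indicator of a degree at most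
`L`. -/
theorem one_le_two_sqrt_mul_birthWeight {d : ℕ} (hd : 1 ≤ d) {L : ℝ} (hL : d ≤ L) :
    1 ≤ 2 * √L * birthWeight d := by
  have h0 : 0 ≤ L := (Nat.cast_nonneg d).trans hL
  have h1 := birthWeight_pos d
  rw [← one_le_sq_iff₀ (by positivity), mul_pow, mul_pow, Real.sq_sqrt h0]
  refine (one_le_four_mul_birthWeight_sq hd).trans ?_
  norm_num
  gcongr

/-- Exact for at most one hit. For two hits, the coefficient `1/d²` is slightly larger than needed,
so that it cancels against the probability `(d/N)²` of a double hit, where `N` is the total degree.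
-/
theorem birthWeight_add_ite_le {d : ℕ} (hd : 1 ≤ d) (P Q : Prop) [Decidable P] [Decidable Q] :
    birthWeight (d + ((if P then 1 else 0) + (if Q then 1 else 0))) ≤
      birthWeight d + -(birthWeight d / (2 * d)) * (if P then 1 else 0) +
        -(birthWeight d / (2 * d)) * (if Q then 1 else 0) +
          birthWeight d / d ^ 2 * ((if P then 1 else 0) * (if Q then 1 else 0)) := by
  have hd0 := one_le_cast hd
  have hb := birthWeight_pos d
  by_cases hP : P <;> by_cases hQ : Q <;>
    simp only [hP, hQ, if_true, if_false, add_zero, zero_add, mul_zero, mul_one, le_refl]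
  · rw [← add_assoc, birthWeight_succ (by omega), birthWeight_succ hd]
    rw [show birthWeight d + -(birthWeight d / (2 * d)) + -(birthWeight d / (2 * d)) +
      birthWeight d / (d : ℝ) ^ 2 = birthWeight d * (1 - 1 / d + 1 / (d : ℝ) ^ 2) by
        field_simp; ring, mul_assoc]
    gcongr
    push_cast
    rw [← sub_nonneg]
    have : (1 - 1 / (d : ℝ) + 1 / (d : ℝ) ^ 2) -
        (1 - 1 / (2 * (d : ℝ))) * (1 - 1 / (2 * ((d : ℝ) + 1))) =
        (d + 4) / (4 * d ^ 2 * (d + 1)) := by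
      field_simp
      ring
    rw [this]
    positivity
  · rw [birthWeight_succ hd]
    apply le_of_eq
    ring
  · rw [birthWeight_succ hd]
    apply le_of_eq
    ring

/-- An end hits `v` with probability `d/N`, where `N = 2(t+1)`, and a hit costs the fraction
`1/(2d)`. The degree cancels: an edge-operation contributes the factor `1 - 1/N + 1/N²` whatever `d`
is. Vertex-operations are only used not to increase the weight. -/
theorem stepMean_birthWeight_le {t : ℕ} {G : Multigraph} (hG : Reachable t G) {v : ℕ}
    (hv : v < G.order) (p : unitInterval) :
    stepMean p (fun H => birthWeight (H.degree v)) G ≤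
      (1 - (1 - p) * (1 / (2 * (t + 1)) - (1 / (2 * (t + 1))) ^ 2)) *
        birthWeight (G.degree v) := by
  have hd := hG.one_le_degree v hv
  have hd0 := one_le_cast hd
  have hp' : (0 : ℝ) ≤ 1 - p := sub_nonneg.mpr p.2.2
  have hN := hG.totalDegree_pos
  have h1 : G.attachMean (fun u => birthWeight ((G.addVertex u).degree v)) ≤
      birthWeight (G.degree v) := by
    rw [← G.attachMean_const (birthWeight (G.degree v))]
    refine G.attachMean_mono fun u => ?_
    rw [degree_addVertex, if_neg hv.ne, add_zero]
    split_ifs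
    · exact birthWeight_succ_le hd
    · exact le_rfl
  have hq : G.attachMean (fun u => if v = (u : ℕ) then 1 else 0) =
      G.degree v / G.totalDegree := by
    simp only [← G.attachMean_ite_eq hv, eq_comm]
  have h2 : G.attachMean (fun u => G.attachMean fun w => birthWeight ((G.addEdge u w).degree v)) ≤
      birthWeight (G.degree v) *
        (1 - (1 / (2 * ((t : ℝ) + 1)) - (1 / (2 * ((t : ℝ) + 1))) ^ 2)) := by
    simp only [degree_addEdge]
    refine (G.attachMean_mono fun u => G.attachMean_mono fun w =>
      birthWeight_add_ite_le hd _ _).trans ?_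
    rw [G.attachMean_attachMean_bilinear (fun u => if v = (u : ℕ) then 1 else 0)
      (fun u => if v = (u : ℕ) then 1 else 0), hq, ← hG.totalDegree_eq]
    apply le_of_eq
    field_simp
    ring
  calc _ ≤ p * birthWeight (G.degree v) + (1 - p) * (birthWeight (G.degree v) *
        (1 - (1 / (2 * ((t : ℝ) + 1)) - (1 / (2 * ((t : ℝ) + 1))) ^ 2))) :=
        add_le_add (mul_le_mul_of_nonneg_left h1 p.2.1) (mul_le_mul_of_nonneg_left h2 hp')
    _ = _ := by ring

/-- The weight of the degree of a vertex decays polynomially. -/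
theorem evolve_birthWeight_le (p : ℕ → unitInterval) {s : ℕ} {κ : ℝ} (hκ : 0 ≤ κ)
    (hp : ∀ r, s ≤ r → 2 * κ ≤ (1 - p r) * (1 - 1 / (2 * ((s : ℝ) + 1))))
    {G : Multigraph} (hG : Reachable s G) {v : ℕ} (hv : v < G.order) (n : ℕ) :
    evolve p s n (fun H => birthWeight (H.degree v)) G ≤ ((s + 1) / (s + n + 1) : ℝ) ^ κ := by
  induction n with
  | zero =>
    rw [Nat.cast_zero, add_zero, div_self (by positivity), Real.one_rpow]
    exact birthWeight_le_one _
  | succ n ih =>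
    have key : ∀ H, Reachable (s + n) H ∧ v < H.order →
        stepMean (p (s + n)) (fun H => birthWeight (H.degree v)) H ≤
          ((s + n + 1) / (s + n + 2) : ℝ) ^ κ * birthWeight (H.degree v) := by
      intro H hH
      refine (stepMean_birthWeight_le hH.1 hH.2 _).trans ?_
      refine mul_le_mul_of_nonneg_right ?_ (birthWeight_pos _).le
      push_cast
      have h0 : (0 : ℝ) < s + n + 1 := by positivity
      have h1 := hp (s + n) (by omega)
      have hp' : (0 : ℝ) ≤ 1 - p (s + n) := sub_nonneg.mpr (p _).2.2
      have h2 : (1 - p (s + n) : ℝ) * (1 / (2 * ((s : ℝ) + n + 1)) - (1 / (2 * ((s : ℝ) + n + 1))) ^ 2)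
          = (1 - p (s + n)) * (1 - 1 / (2 * ((s : ℝ) + n + 1))) / (2 * (s + n + 1)) := by
        field_simp
      have h3 : (1 : ℝ) / (2 * ((s : ℝ) + n + 1)) ≤ 1 / (2 * ((s : ℝ) + 1)) := by
        gcongr
        linarith [(Nat.cast_nonneg n : (0 : ℝ) ≤ n)]
      have h4 : 2 * κ ≤ (1 - p (s + n)) * (1 - 1 / (2 * ((s : ℝ) + n + 1))) :=
        h1.trans (mul_le_mul_of_nonneg_left (by linarith) hp')
      rw [h2]
      have h5 : κ / (s + n + 1) ≤
          (1 - p (s + n)) * (1 - 1 / (2 * ((s : ℝ) + n + 1))) / (2 * (s + n + 1)) := by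
        rw [div_le_div_iff₀ h0 (by positivity)]
        nlinarith
      -- With `x = s + n + 1` the factor of this step is at most `1 - κ/x ≤ exp(-κ/x) ≤
      -- (x/(x+1))^κ`, and these powers telescope.
      have h6 : Real.log ((s + n + 2) / (s + n + 1) : ℝ) ≤ 1 / (s + n + 1) := by
        refine (Real.log_le_sub_one_of_pos (by positivity)).trans (le_of_eq ?_)
        field_simp
        ring
      calc _ ≤ 1 - κ / (s + n + 1) := by linarith
        _ ≤ Real.exp (-(κ / (s + n + 1))) := by
          linarith [Real.add_one_le_exp (-(κ / (s + n + 1)))]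
        _ ≤ _ := by
          rw [Real.rpow_def_of_pos (by positivity), Real.exp_le_exp,
            ← inv_div ((s : ℝ) + n + 2), Real.log_inv]
          have := mul_le_mul_of_nonneg_right h6 hκ
          rw [one_div, inv_mul_eq_div] at this
          linarith
    refine (evolve_succ_le p s (persistent_reachable.and (persistent_lt_order v)) ⟨hG, hv⟩ n
      key).trans ?_
    rw [evolve_const_mul]
    calc _ ≤ ((s + n + 1) / (s + n + 2) : ℝ) ^ κ * ((s + 1) / (s + n + 1) : ℝ) ^ κ := by gcongr
      _ = _ := by
        rw [← Real.mul_rpow (by positivity) (by positivity)]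
        congr 1
        push_cast
        field_simp
        ring

/-! ### Adjacency of vertices of large degree -/

open Classical in
/-- The indicator function of the graphs without an edge between `u` and `v`. -/
noncomputable def nonadj (u v : ℕ) (G : Multigraph) : ℝ := if s(u, v) ∈ G.edges then 0 else 1

theorem nonadj_nonneg (u v : ℕ) (G : Multigraph) : 0 ≤ nonadj u v G := by
  unfold nonadj
  positivity

/-- Only the draw of `u` first and `v` second is counted; the reversed draw is given away. The zero
coefficients match the form in `attachMean_attachMean_bilinear`. -/
theorem nonadj_addEdge_le {G : Multigraph} {u v : ℕ} (a b : Fin G.order) :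
    nonadj u v (G.addEdge a b) ≤
      1 + 0 * (if (a : ℕ) = u then 1 else 0) + 0 * (if (b : ℕ) = v then 1 else 0) +
        -1 * ((if (a : ℕ) = u then 1 else 0) * (if (b : ℕ) = v then 1 else 0)) := by
  unfold nonadj
  by_cases ha : (a : ℕ) = u <;> by_cases hb : (b : ℕ) = v <;>
    simp only [ha, hb, if_true, if_false] <;> norm_num
  · simp [addEdge, ha, hb]
  all_goals split_ifs <;> norm_num

theorem stepMean_nonadj_le {t : ℕ} {G : Multigraph} (hG : Reachable t G) {u v : ℕ} {L : ℝ}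
    (hL : 0 < L) (hu : L ≤ G.degree u) (hv : L ≤ G.degree v) (p : unitInterval) :
    stepMean p (nonadj u v) G ≤ (1 - (1 - p) * (L / (2 * (t + 1))) ^ 2) * nonadj u v G := by
  have hp' : (0 : ℝ) ≤ 1 - p := sub_nonneg.mpr p.2.2
  have lt_order : ∀ {w}, L ≤ G.degree w → w < G.order := fun {w} hw => by
    by_contra h
    rw [G.degree_eq_zero_of_le (not_lt.mp h), Nat.cast_zero] at hw
    linarith
  by_cases h : s(u, v) ∈ G.edges
  · have h1 : ∀ a, nonadj u v (G.addVertex a) = 0 := fun a =>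
      if_pos (Multiset.mem_cons_of_mem h)
    have h2 : ∀ a b, nonadj u v (G.addEdge a b) = 0 := fun a b =>
      if_pos (Multiset.mem_cons_of_mem h)
    have h0 : nonadj u v G = 0 := if_pos h
    simp only [stepMean, h0, h1, h2, attachMean_const, mul_zero, add_zero, le_refl]
  · have h0 : nonadj u v G = 1 := if_neg h
    have h1 : G.attachMean (fun a => nonadj u v (G.addVertex a)) ≤ 1 := by
      rw [← G.attachMean_const 1]
      refine G.attachMean_mono fun a => ?_
      unfold nonadj
      split_ifs <;> norm_num
    have h2 : G.attachMean (fun a => G.attachMean fun b => nonadj u v (G.addEdge a b)) ≤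
        1 - (L / (2 * (t + 1))) ^ 2 := by
      refine (G.attachMean_mono fun a => G.attachMean_mono fun b =>
        nonadj_addEdge_le a b).trans ?_
      rw [G.attachMean_attachMean_bilinear (fun a => if (a : ℕ) = u then 1 else 0)
        (fun b => if (b : ℕ) = v then 1 else 0), G.attachMean_ite_eq (lt_order hu),
        G.attachMean_ite_eq (lt_order hv), hG.totalDegree_eq]
      have : (L / (2 * ((t : ℝ) + 1))) ^ 2 ≤
          G.degree u / (2 * ((t : ℝ) + 1)) * (G.degree v / (2 * ((t : ℝ) + 1))) := by
        rw [sq]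
        gcongr
      linarith
    rw [h0]
    calc _ ≤ p * 1 + (1 - p) * (1 - (L / (2 * ((t : ℝ) + 1))) ^ 2) :=
          add_le_add (mul_le_mul_of_nonneg_left h1 p.2.1) (mul_le_mul_of_nonneg_left h2 hp')
      _ = _ := by ring

/-- Vertices of large degree are unlikely to stay nonadjacent. -/
theorem evolve_nonadj_le (p : ℕ → unitInterval) {s : ℕ} {u v : ℕ} {L : ℝ} (hL : 0 < L)
    (hp : ∀ r, s ≤ r → (p r : ℝ) ≤ 1 / 2) {G : Multigraph} (hG : Reachable s G)
    (hu : L ≤ G.degree u) (hv : L ≤ G.degree v) {T : ℕ} (n : ℕ) (hT : s + n ≤ T) :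
    evolve p s n (nonadj u v) G ≤ Real.exp (-(L ^ 2 / (8 * T ^ 2))) ^ n := by
  induction n with
  | zero =>
    rw [pow_zero]
    change nonadj u v G ≤ 1
    unfold nonadj
    split_ifs <;> norm_num
  | succ n ih =>
    have key : ∀ H, Reachable (s + n) H ∧ L ≤ H.degree u ∧ L ≤ H.degree v →
        stepMean (p (s + n)) (nonadj u v) H ≤
          Real.exp (-(L ^ 2 / (8 * T ^ 2))) * nonadj u v H := by
      intro H hH
      refine (stepMean_nonadj_le hH.1 hL hH.2.1 hH.2.2 _).trans ?_
      refine mul_le_mul_of_nonneg_right ?_ (nonadj_nonneg _ _ _)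
      refine le_trans ?_ (Real.add_one_le_exp _)
      have h1 := hp (s + n) (by omega)
      have h2 : ((s + n : ℕ) : ℝ) + 1 ≤ T := by exact_mod_cast hT
      have h3 : (L / (2 * (T : ℝ))) ^ 2 ≤ (L / (2 * (((s + n : ℕ) : ℝ) + 1))) ^ 2 := by
        gcongr
      -- The 8 is `2 · 2²`: edge-operations have probability at least `1/2`, and the total degree is
      -- at most `2T`.
      have h4 : L ^ 2 / (8 * (T : ℝ) ^ 2) = 1 / 2 * (L / (2 * (T : ℝ))) ^ 2 := by ring
      have h5 : 1 / 2 * (L / (2 * (T : ℝ))) ^ 2 ≤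
          (1 - p (s + n)) * (L / (2 * (((s + n : ℕ) : ℝ) + 1))) ^ 2 := by
        exact mul_le_mul (by linarith) h3 (sq_nonneg _) (by linarith)
      linarith
    refine (evolve_succ_le p s (persistent_reachable.and
      ((persistent_degree L u).and (persistent_degree L v))) ⟨hG, hu, hv⟩ n key).trans ?_
    rw [evolve_const_mul, pow_succ' (Real.exp _)]
    exact mul_le_mul_of_nonneg_left (ih (by omega)) (Real.exp_nonneg _)

/-! ### Degrees and edges of the late vertices -/

/-- The total degree of the vertices with labels at least `m`. -/
noncomputable def lateDegree (m : ℕ) (G : Multigraph) : ℝ :=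
  G.weightedDegree fun v => if m ≤ v then 1 else 0

open Classical in
/-- The number of edges with both ends among the vertices with labels at least `m`. -/
noncomputable def lateEdges (m : ℕ) (G : Multigraph) : ℕ :=
  G.edges.countP fun e => ∀ v ∈ e, m ≤ v

theorem lateDegree_nonneg (m : ℕ) (G : Multigraph) : 0 ≤ G.lateDegree m :=
  Finset.sum_nonneg (s := Finset.univ (α := Fin G.order)) fun v _ => by positivity

theorem attachMean_late (m : ℕ) (G : Multigraph) :
    G.attachMean (fun u => if m ≤ (u : ℕ) then 1 else 0) = G.lateDegree m / G.totalDegree :=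
  G.attachMean_eq_weightedDegree fun v => if m ≤ v then 1 else 0

theorem attachMean_late_le_one (m : ℕ) (G : Multigraph) :
    G.lateDegree m / G.totalDegree ≤ 1 := by
  rw [← attachMean_late]
  refine (G.attachMean_mono (ψ := fun _ => 1) fun u => ?_).trans (G.attachMean_const 1).le
  by_cases hu : m ≤ (u : ℕ) <;> simp [hu]

theorem lateDegree_eq_zero {m : ℕ} {G : Multigraph} (h : G.order ≤ m) : G.lateDegree m = 0 :=
  Finset.sum_eq_zero (s := Finset.univ (α := Fin G.order)) fun v _ => by
    simp only [if_neg (show ¬m ≤ (v : ℕ) by omega), mul_zero]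

theorem lateEdges_eq_zero {m : ℕ} {G : Multigraph} (h : G.order ≤ m) : G.lateEdges m = 0 := by
  classical
  rw [lateEdges, Multiset.countP_eq_zero]
  intro e he h'
  have h1 := G.lt_order e he _ (Sym2.out_fst_mem e)
  have h2 := h' _ (Sym2.out_fst_mem e)
  omega

theorem lateDegree_addVertex_le (m : ℕ) (G : Multigraph) (u : Fin G.order) :
    (G.addVertex u).lateDegree m ≤ G.lateDegree m + ((if m ≤ (u : ℕ) then 1 else 0) + 1) := by
  rw [lateDegree, weightedDegree_addVertex]
  have : (if m ≤ G.order then 1 else 0 : ℝ) ≤ 1 := by split_ifs <;> norm_num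
  exact add_le_add le_rfl (add_le_add le_rfl this)

theorem lateDegree_addEdge (m : ℕ) (G : Multigraph) (u w : Fin G.order) :
    (G.addEdge u w).lateDegree m =
      G.lateDegree m + ((if m ≤ (u : ℕ) then 1 else 0) + (if m ≤ (w : ℕ) then 1 else 0)) :=
  G.weightedDegree_addEdge u w _

theorem stepMean_lateDegree_le (m : ℕ) (p : unitInterval) (G : Multigraph) :
    stepMean p (lateDegree m) G ≤
      G.lateDegree m + p + 2 * (G.lateDegree m / G.totalDegree) := by
  have hp := p.2.1
  have hp' : (0 : ℝ) ≤ 1 - p := sub_nonneg.mpr p.2.2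
  have h1 : G.attachMean (fun u => (G.addVertex u).lateDegree m) ≤
      G.lateDegree m + (G.lateDegree m / G.totalDegree + 1) := by
    refine (G.attachMean_mono fun u => lateDegree_addVertex_le m G u).trans ?_
    rw [attachMean_add, attachMean_add, attachMean_const, attachMean_const, attachMean_late]
  have h2 : G.attachMean (fun u => G.attachMean fun w => (G.addEdge u w).lateDegree m) =
      G.lateDegree m + 2 * (G.lateDegree m / G.totalDegree) := by
    simp only [lateDegree_addEdge, attachMean_add, attachMean_const, attachMean_late]
    ring
  have h3 : 0 ≤ G.lateDegree m / G.totalDegree := div_nonneg (lateDegree_nonneg _ _) (by positivity)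
  calc _ ≤ p * (G.lateDegree m + (G.lateDegree m / G.totalDegree + 1)) +
        (1 - p) * (G.lateDegree m + 2 * (G.lateDegree m / G.totalDegree)) :=
        add_le_add (mul_le_mul_of_nonneg_left h1 hp) (mul_le_mul_of_nonneg_left h2.le hp')
    _ ≤ _ := by nlinarith

theorem stepMean_lateDegree_sq_le (m : ℕ) (p : unitInterval) (G : Multigraph) :
    stepMean p (fun H => H.lateDegree m ^ 2) G ≤
      G.lateDegree m ^ 2 + p * (2 * G.lateDegree m + 1) +
        (4 * G.lateDegree m + 4) * (G.lateDegree m / G.totalDegree) := by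
  have hp := p.2.1
  have hp' : (0 : ℝ) ≤ 1 - p := sub_nonneg.mpr p.2.2
  have hD := lateDegree_nonneg m G
  have hq := attachMean_late m G
  have hq1 := attachMean_late_le_one m G
  have hq0 : 0 ≤ G.lateDegree m / G.totalDegree := div_nonneg hD (by positivity)
  set q := G.lateDegree m / G.totalDegree
  set D := G.lateDegree m
  have h1 : G.attachMean (fun u => (G.addVertex u).lateDegree m ^ 2) ≤
      (D ^ 2 + 2 * D + 1) + (2 * D + 3) * q := by
    rw [← hq, ← attachMean_const_mul, ← G.attachMean_const (D ^ 2 + 2 * D + 1), ← attachMean_add]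
    refine G.attachMean_mono fun u => ?_
    have h := lateDegree_addVertex_le m G u
    refine (pow_le_pow_left₀ (lateDegree_nonneg _ _) h 2).trans (le_of_eq ?_)
    split_ifs <;> ring
  have h2 : G.attachMean (fun u => G.attachMean fun w => (G.addEdge u w).lateDegree m ^ 2) =
      D ^ 2 + (2 * D + 1) * q + (2 * D + 1) * q + 2 * (q * q) := by
    rw [← hq, ← attachMean_attachMean_bilinear]
    congr 1
    funext u
    congr 1
    funext w
    rw [lateDegree_addEdge]
    split_ifs <;> ring
  calc _ ≤ p * ((D ^ 2 + 2 * D + 1) + (2 * D + 3) * q) +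
        (1 - p) * (D ^ 2 + (2 * D + 1) * q + (2 * D + 1) * q + 2 * (q * q)) :=
        add_le_add (mul_le_mul_of_nonneg_left h1 hp) (mul_le_mul_of_nonneg_left h2.le hp')
    _ ≤ p * (D ^ 2 + 2 * D + 1 + (4 * D + 4) * q) + (1 - p) * (D ^ 2 + (4 * D + 4) * q) := by
        exact add_le_add (mul_le_mul_of_nonneg_left (by nlinarith) hp)
          (mul_le_mul_of_nonneg_left (by nlinarith) hp')
    _ = _ := by ring

/-- A vertex-operation can create such an edge only if its old end is late, an edge-operation only
if both independently chosen ends are. -/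
theorem stepMean_lateEdges_le (m : ℕ) (p : unitInterval) (G : Multigraph) :
    stepMean p (fun H => H.lateEdges m) G ≤
      G.lateEdges m + p * (G.lateDegree m / G.totalDegree) +
        (G.lateDegree m / G.totalDegree) ^ 2 := by
  have hp := p.2.1
  have hp' : (0 : ℝ) ≤ 1 - p := sub_nonneg.mpr p.2.2
  have hq := attachMean_late m G
  set q := G.lateDegree m / G.totalDegree
  have h1 : G.attachMean (fun u => ((G.addVertex u).lateEdges m : ℝ)) ≤ G.lateEdges m + q := by
    rw [← hq, ← G.attachMean_const (G.lateEdges m : ℝ), ← attachMean_add]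
    refine G.attachMean_mono fun u => ?_
    simp only [lateEdges, addVertex, Multiset.countP_cons, Sym2.mem_iff, forall_eq_or_imp,
      forall_eq]
    push_cast
    gcongr
    by_cases hu : m ≤ (u : ℕ) <;> by_cases ho : m ≤ G.order <;> simp [hu, ho]
  have h2 : G.attachMean (fun u => G.attachMean fun w => ((G.addEdge u w).lateEdges m : ℝ)) =
      G.lateEdges m + 0 * q + 0 * q + 1 * (q * q) := by
    rw [← hq, ← attachMean_attachMean_bilinear]
    congr 1
    funext u
    congr 1
    funext w
    simp only [lateEdges, addEdge, Multiset.countP_cons, Sym2.mem_iff, forall_eq_or_imp,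
      forall_eq]
    push_cast
    by_cases hu : m ≤ (u : ℕ) <;> by_cases hw : m ≤ (w : ℕ) <;> simp [hu, hw]
  calc _ ≤ p * ((G.lateEdges m : ℝ) + q) +
        (1 - p) * ((G.lateEdges m : ℝ) + 0 * q + 0 * q + 1 * (q * q)) :=
        add_le_add (mul_le_mul_of_nonneg_left h1 hp) (mul_le_mul_of_nonneg_left h2.le hp')
    _ ≤ _ := by nlinarith [sq_nonneg q]

theorem inv_add_one_le_log_sub_log (r : ℕ) :
    1 / ((r : ℝ) + 2) ≤ Real.log (r + 2) - Real.log (r + 1) := by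
  rw [← Real.log_div (by positivity) (by positivity)]
  refine le_trans (le_of_eq ?_) (Real.one_sub_inv_le_log_of_pos (by positivity))
  field_simp
  ring

/-- The mean `D` satisfies `D' ≤ (1 + 1/(r+1)) D + φ` at time `r`, so the bound on `D/(r+1)` grows
by `φ/(r+2)` per step. The logarithm is this harmonic sum; `hm` makes it start from zero. -/
theorem evolve_lateDegree_le (p : ℕ → unitInterval) {s m : ℕ} {φ : ℝ} (hp : ∀ r, s ≤ r → (p r : ℝ) ≤ φ)
    {G : Multigraph} (hG : Reachable s G) (hm : G.order ≤ m) (n : ℕ) :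
    evolve p s n (lateDegree m) G ≤ φ * (s + n + 1) * Real.log (s + n + 1) := by
  have hφ : 0 ≤ φ := (p s).2.1.trans (hp s le_rfl)
  induction n with
  | zero =>
    change G.lateDegree m ≤ _
    rw [lateDegree_eq_zero hm]
    have : 0 ≤ Real.log (s + (0 : ℕ) + 1) := Real.log_nonneg (by simp)
    positivity
  | succ n ih =>
    have key : ∀ H, Reachable (s + n) H → stepMean (p (s + n)) (lateDegree m) H ≤
        (1 + 1 / (s + n + 1)) * H.lateDegree m + φ := fun H hH => by
      refine (stepMean_lateDegree_le m _ H).trans ?_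
      have := hp (s + n) (by omega)
      rw [hH.totalDegree_eq]
      push_cast
      have h : 2 * (H.lateDegree m / (2 * ((s : ℝ) + n + 1))) =
        1 / (s + n + 1) * H.lateDegree m := by field_simp
      linarith
    refine (evolve_succ_le p s persistent_reachable hG n key).trans ?_
    rw [evolve_add, evolve_const, evolve_const_mul]
    have h1 := inv_add_one_le_log_sub_log (s + n)
    push_cast at h1 ⊢
    have e : (s : ℝ) + (n + 1) + 1 = s + n + 2 := by ring
    rw [e]
    calc _ ≤ (1 + 1 / ((s : ℝ) + n + 1)) * (φ * (s + n + 1) * Real.log (s + n + 1)) + φ := by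
          gcongr
      _ = φ * (s + n + 2) * (Real.log (s + n + 1) + 1 / (s + n + 2)) := by
          field_simp
          ring
      _ ≤ _ := by
          gcongr
          linarith

/-- The homogeneous recursion has factor `1 + 2/(r+1)`, which the normalisation by `(r+1)(r+2)`
dominates. The inhomogeneous part is `4φ E D + φ`. Here `E D ≤ φ(r+1)Λ`, and `hφ` absorbs `φ` into
`φ²(r+1)Λ`, whence `5 = 4 + 1`. -/
theorem evolve_lateDegree_sq_le (p : ℕ → unitInterval) {s m : ℕ} {φ : ℝ} (hp : ∀ r, s ≤ r → (p r : ℝ) ≤ φ)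
    {G : Multigraph} (hG : Reachable s G) (hm : G.order ≤ m) (hφ : 1 ≤ φ * (s + 1))
    {Λ : ℝ} (hΛ : 1 ≤ Λ) (n : ℕ) (hn : Real.log (s + n + 1) ≤ Λ) :
    evolve p s n (fun H => H.lateDegree m ^ 2) G ≤
      5 * Λ * φ ^ 2 * ((s + n + 1) * (s + n + 2)) * Real.log (s + n + 1) := by
  have hφ0 : 0 ≤ φ := (p s).2.1.trans (hp s le_rfl)
  induction n with
  | zero =>
    change G.lateDegree m ^ 2 ≤ _
    rw [lateDegree_eq_zero hm, zero_pow two_ne_zero]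
    have : 0 ≤ Real.log (s + (0 : ℕ) + 1) := Real.log_nonneg (by simp)
    positivity
  | succ n ih =>
    have hlog : Real.log (s + n + 1) ≤ Λ := by
      refine (Real.log_le_log (by positivity) ?_).trans hn
      push_cast
      linarith
    have h0 : (1 : ℝ) ≤ φ * (s + n + 1) := by
      nlinarith [(Nat.cast_nonneg n : (0 : ℝ) ≤ n)]
    have key : ∀ H, Reachable (s + n) H →
        stepMean (p (s + n)) (fun H => H.lateDegree m ^ 2) H ≤
          (1 + 2 / (s + n + 1)) * H.lateDegree m ^ 2 + 4 * φ * H.lateDegree m + φ := fun H hH => by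
      refine (stepMean_lateDegree_sq_le m _ H).trans ?_
      have h1 := hp (s + n) (by omega)
      have hD := lateDegree_nonneg m H
      have h2 : 1 / ((s : ℝ) + n + 1) ≤ φ := by
        rw [div_le_iff₀ (by positivity)]
        exact h0
      rw [hH.totalDegree_eq]
      push_cast
      have h : (4 * H.lateDegree m + 4) * (H.lateDegree m / (2 * ((s : ℝ) + n + 1))) =
        2 / (s + n + 1) * H.lateDegree m ^ 2 + 2 * (1 / (s + n + 1)) * H.lateDegree m := by
          field_simp
          ring
      rw [h]
      nlinarith
    refine (evolve_succ_le p s persistent_reachable hG n key).trans ?_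
    rw [evolve_add, evolve_const, evolve_add, evolve_const_mul, evolve_const_mul]
    have h1 := inv_add_one_le_log_sub_log (s + n)
    have h2 := evolve_lateDegree_le p hp hG hm n
    have h3 := ih hlog
    push_cast at h1 ⊢
    have e : (s : ℝ) + (n + 1) + 1 = s + n + 2 := by ring
    have e' : (s : ℝ) + (n + 1) + 2 = s + n + 3 := by ring
    rw [e, e']
    have h4 : evolve p s n (lateDegree m) G ≤ φ * (s + n + 1) * Λ := h2.trans (by gcongr)
    have h5 : φ ≤ φ ^ 2 * (s + n + 1) * Λ := by
      calc φ = φ * 1 * 1 := by ring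
        _ ≤ φ * (φ * (s + n + 1)) * Λ := by gcongr
        _ = _ := by ring
    calc _ ≤ (1 + 2 / ((s : ℝ) + n + 1)) *
            (5 * Λ * φ ^ 2 * ((s + n + 1) * (s + n + 2)) * Real.log (s + n + 1)) +
          4 * φ * (φ * (s + n + 1) * Λ) + φ ^ 2 * (s + n + 1) * Λ := by gcongr
      _ = 5 * Λ * φ ^ 2 * ((s + n + 2) * (s + n + 3)) * (Real.log (s + n + 1) +
          ((s : ℝ) + n + 1) / (s + n + 3) * (1 / (s + n + 2))) := by
          field_simp
          ring
      _ ≤ 5 * Λ * φ ^ 2 * ((s + n + 2) * (s + n + 3)) * (Real.log (s + n + 1) +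
          1 * (1 / (s + n + 2))) := by
          gcongr
          rw [div_le_one (by positivity)]
          linarith
      _ ≤ _ := by
          gcongr
          linarith

/-- With `q` the fraction of late degree, a step adds at most `φ E q + E q²`. The two moment bounds
make these `1/2` and `5/2` times `(φΛ)²`, hence the 3. The second moment is needed because both ends
must be late. -/
theorem evolve_lateEdges_le (p : ℕ → unitInterval) {s m : ℕ} {φ : ℝ} (hp : ∀ r, s ≤ r → (p r : ℝ) ≤ φ)
    {G : Multigraph} (hG : Reachable s G) (hm : G.order ≤ m) (hφ : 1 ≤ φ * (s + 1))
    {Λ : ℝ} (hΛ : 1 ≤ Λ) (n : ℕ) (hn : Real.log (s + n + 1) ≤ Λ) :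
    evolve p s n (fun H => H.lateEdges m) G ≤ 3 * n * (φ * Λ) ^ 2 := by
  have hφ0 : 0 ≤ φ := (p s).2.1.trans (hp s le_rfl)
  induction n with
  | zero =>
    change (G.lateEdges m : ℝ) ≤ _
    rw [lateEdges_eq_zero hm]
    simp
  | succ n ih =>
    have hlog : Real.log (s + n + 1) ≤ Λ := by
      refine (Real.log_le_log (by positivity) ?_).trans hn
      push_cast
      linarith
    have key : ∀ H, Reachable (s + n) H →
        stepMean (p (s + n)) (fun H => H.lateEdges m) H ≤
          H.lateEdges m + φ / (2 * (s + n + 1)) * H.lateDegree m +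
            1 / (2 * (s + n + 1)) ^ 2 * H.lateDegree m ^ 2 := fun H hH => by
      refine (stepMean_lateEdges_le m _ H).trans ?_
      have h1 := hp (s + n) (by omega)
      have hD := lateDegree_nonneg m H
      rw [hH.totalDegree_eq]
      push_cast
      rw [div_pow, div_mul_eq_mul_div φ, one_div_mul_eq_div, ← mul_div_assoc]
      gcongr
    refine (evolve_succ_le p s persistent_reachable hG n key).trans ?_
    rw [evolve_add, evolve_add, evolve_const_mul, evolve_const_mul]
    have h1 := evolve_lateDegree_le p hp hG hm n
    have h2 := evolve_lateDegree_sq_le p hp hG hm hφ hΛ n hlog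
    have h4 : 0 ≤ Real.log (s + n + 1) := Real.log_nonneg (by linarith [s.cast_nonneg (α := ℝ), n.cast_nonneg (α := ℝ)])
    have h3 := ih hlog
    push_cast
    calc _ ≤ 3 * n * (φ * Λ) ^ 2 +
          φ / (2 * ((s : ℝ) + n + 1)) * (φ * (s + n + 1) * Λ) +
          1 / (2 * ((s : ℝ) + n + 1)) ^ 2 *
            (5 * Λ * φ ^ 2 * ((s + n + 1) * (s + n + 1 + (s + n + 1))) * Λ) := by
          have h5 : (s : ℝ) + n + 2 ≤ s + n + 1 + (s + n + 1) := by
            linarith [s.cast_nonneg (α := ℝ), n.cast_nonneg (α := ℝ)]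
          have h6 := h1.trans (mul_le_mul_of_nonneg_left hlog (by positivity))
          have h7 : evolve p s n (fun H => H.lateDegree m ^ 2) G ≤ 5 * Λ * φ ^ 2 *
              ((s + n + 1) * (s + n + 1 + (s + n + 1))) * Λ := h2.trans (by gcongr)
          gcongr
      _ = 3 * n * (φ * Λ) ^ 2 + φ ^ 2 * Λ * (1 / 2) + 5 / 2 * (φ * Λ) ^ 2 := by
          field_simp
          ring
      _ ≤ 3 * n * (φ * Λ) ^ 2 + φ ^ 2 * Λ * (1 / 2 * Λ) + 5 / 2 * (φ * Λ) ^ 2 := by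
          gcongr
          linarith
      _ = _ := by ring

/-! ### Cliques: combinatorial bounds and the upper tail -/

theorem card_le_cliqueNumber {G : Multigraph} {S : Finset ℕ} (hS : ∀ v ∈ S, v < G.order)
    (h : ∀ u ∈ S, ∀ v ∈ S, u ≠ v → s(u, v) ∈ G.edges) : S.card ≤ G.cliqueNumber := by
  have hc : G.simplification.IsClique (S.attachFin hS : Finset (Fin G.order)) := by
    intro u hu v hv huv
    rw [Finset.mem_coe, Finset.mem_attachFin] at hu hv
    exact ⟨huv, h u hu v hv fun h => huv (Fin.ext h)⟩
  rw [← Finset.card_attachFin S hS]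
  exact hc.card_le_cliqueNum

/-- A clique loses at most `m` vertices with labels below `m`, and distinct pairs of the others need
distinct late edges. -/
theorem choose_two_le_lateEdges (m : ℕ) (G : Multigraph) :
    (G.cliqueNumber - m).choose 2 ≤ G.lateEdges m := by
  classical
  obtain ⟨S, hS, hcard⟩ := G.simplification.exists_isNClique_cliqueNum
  set R : Finset ℕ := (S.map Fin.valEmbedding) \ Finset.range m
  have h1 : G.cliqueNumber - m ≤ R.card := by
    refine le_trans ?_ (Finset.le_card_sdiff _ _)
    rw [Finset.card_range, Finset.card_map, hcard]
    rfl
  refine (Nat.choose_le_choose 2 h1).trans ?_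
  rw [← Sym2.card_image_offDiag, lateEdges, Multiset.countP_eq_card_filter]
  refine le_trans (Finset.card_le_card (t := (G.edges.filter fun e => ∀ v ∈ e, m ≤ v).toFinset)
    fun e he => ?_) (Multiset.toFinset_card_le _)
  obtain ⟨⟨u, v⟩, huv, rfl⟩ := Finset.mem_image.mp he
  obtain ⟨hu, hv, hne⟩ := Finset.mem_offDiag.mp huv
  simp only [R, Finset.mem_sdiff, Finset.mem_map, Finset.mem_range, not_lt] at hu hv
  obtain ⟨⟨a, ha, rfl⟩, hu⟩ := hu
  obtain ⟨⟨b, hb, rfl⟩, hv⟩ := hv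
  rw [Multiset.mem_toFinset, Multiset.mem_filter]
  refine ⟨(hS ha hb fun h => hne (by rw [h])).2, ?_⟩
  intro w hw
  rcases Sym2.mem_iff.mp hw with rfl | rfl
  · exact hu
  · exact hv

open Classical in
/-- The indicator function of a clique number less than `M`. -/
noncomputable def smallClique (M : ℝ) (G : Multigraph) : ℝ :=
  if (G.cliqueNumber : ℝ) < M then 1 else 0

open Classical in
/-- The indicator function of a clique number greater than `M`. -/
noncomputable def largeClique (M : ℝ) (G : Multigraph) : ℝ :=
  if M < (G.cliqueNumber : ℝ) then 1 else 0

theorem smallClique_le_one (M : ℝ) (G : Multigraph) : smallClique M G ≤ 1 := by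
  unfold smallClique
  split_ifs <;> norm_num

theorem largeClique_le_one (M : ℝ) (G : Multigraph) : largeClique M G ≤ 1 := by
  unfold largeClique
  split_ifs <;> norm_num

theorem evolve_le_one (p : ℕ → unitInterval) (s n : ℕ) {g : Multigraph → ℝ} (h : ∀ H, g H ≤ 1)
    (G : Multigraph) : evolve p s n g G ≤ 1 := by
  refine (evolve_mono p s (P := fun _ _ => True)
    (fun _ _ _ => ⟨fun _ => trivial, fun _ _ => trivial⟩) trivial n fun H _ => h H).trans
    (evolve_const p s n 1 G).le

theorem probCliqueBetween_ge (f : ℝ → unitInterval) (t : ℕ) (A B : ℝ) :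
    1 - evolve (fun r => f ((r : ℝ) + 1)) 0 t (smallClique A) loop -
      evolve (fun r => f ((r : ℝ) + 1)) 0 t (largeClique B) loop ≤ probCliqueBetween f t A B := by
  classical
  rw [probCliqueBetween, graphLaw_real, sub_sub, sub_le_iff_le_add, ← evolve_add, ← evolve_add]
  refine (evolve_const (fun r => f ((r : ℝ) + 1)) 0 t 1 loop).ge.trans
    (evolve_mono _ 0 persistent_reachable Reachable.loop t fun H _ => ?_)
  unfold smallClique largeClique
  simp only [Set.mem_ofPred_eq]
  split_ifs with h1 h2 h3
  all_goals norm_num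
  exact h1 ⟨not_lt.mp ‹_›, not_lt.mp ‹_›⟩

/-- With `x = ω - m > B - m ≥ 2`, where `ω` is the clique number, one has `x(x-1)/2 ≥ x²/4`. This
bounds the indicator by a multiple of the number of late edges, for Markov's inequality. -/
theorem largeClique_le {m : ℕ} {B : ℝ} (hB : (m : ℝ) + 2 ≤ B) (G : Multigraph) :
    largeClique B G ≤ 4 / (B - m) ^ 2 * G.lateEdges m := by
  have h0 : 0 < B - m := by linarith
  unfold largeClique
  split_ifs with h
  · rw [div_mul_eq_mul_div, one_le_div (by positivity)]
    have hm : m ≤ G.cliqueNumber := by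
      have : (m : ℝ) ≤ G.cliqueNumber := by linarith
      exact_mod_cast this
    have h1 : (((G.cliqueNumber - m).choose 2 : ℕ) : ℝ) ≤ G.lateEdges m := by
      exact_mod_cast choose_two_le_lateEdges m G
    rw [Nat.cast_choose_two, Nat.cast_sub hm] at h1
    nlinarith
  · positivity

/-- An upper bound for the probability of a large clique. -/
theorem evolve_largeClique_le (p : ℕ → unitInterval) {s n m : ℕ} {φ Λ B : ℝ}
    (hp : ∀ r, s ≤ r → (p r : ℝ) ≤ φ) (hφ : 1 ≤ φ * (s + 1)) (hΛ : 1 ≤ Λ)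
    (hn : Real.log (s + n + 1) ≤ Λ) (hm : 0 < m) (hB : (m : ℝ) + 2 ≤ B) :
    evolve p 0 (s + n) (largeClique B) loop ≤
      (1 + ∑ r ∈ Finset.range s, (p r : ℝ)) / m + 12 * n * (φ * Λ) ^ 2 / (B - m) ^ 2 := by
  have hm0 : (0 : ℝ) < m := by exact_mod_cast hm
  have h0 : 0 < B - m := by linarith
  have key : ∀ H, Reachable (0 + s) H → evolve p (0 + s) n (largeClique B) H ≤
      1 / m * H.order + 12 * n * (φ * Λ) ^ 2 / (B - m) ^ 2 := by
    intro H hH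
    rw [zero_add] at hH ⊢
    -- If at most `m` vertices exist at time `s`, no vertex is late yet and the first moment of late
    -- edges applies. Otherwise `order/m` exceeds 1, which pays for the trivial bound.
    by_cases ho : H.order ≤ m
    · have h1 : evolve p s n (largeClique B) H ≤ 4 / (B - m) ^ 2 * (3 * n * (φ * Λ) ^ 2) := by
        refine (evolve_mono p s persistent_reachable hH n fun K _ => largeClique_le hB K).trans ?_
        rw [evolve_const_mul]
        exact mul_le_mul_of_nonneg_left (evolve_lateEdges_le p hp hH ho hφ hΛ n hn) (by positivity)
      have h2 : (0 : ℝ) ≤ 1 / m * H.order := by positivity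
      have h3 : 4 / (B - m) ^ 2 * (3 * n * (φ * Λ) ^ 2) =
        12 * n * (φ * Λ) ^ 2 / (B - m) ^ 2 := by ring
      linarith
    · have h1 := evolve_le_one p s n (largeClique_le_one B) H
      have h2 : (1 : ℝ) ≤ 1 / m * H.order := by
        rw [one_div_mul_eq_div, one_le_div hm0]
        exact_mod_cast (not_le.mp ho).le
      have h3 : (0 : ℝ) ≤ 12 * n * (φ * Λ) ^ 2 / (B - m) ^ 2 := by positivity
      linarith
  rw [evolve_comp]
  refine (evolve_mono p 0 persistent_reachable Reachable.loop s key).trans (le_of_eq ?_)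
  rw [evolve_add, evolve_const_mul, evolve_const, evolve_order]
  ring

/-! ### The lower tail -/

open Classical in
/-- The labels below `m` of the vertices of degree at least `L`. -/
noncomputable def hubs (m : ℕ) (L : ℝ) (G : Multigraph) : Finset ℕ :=
  (Finset.range m).filter fun v => L ≤ G.degree v

/-- Union bound over ordered pairs of hubs of the starting graph. The set of hubs is frozen, since
its members keep their degree bound; if all of them are adjacent they form a clique of size at least
`M`. -/
theorem evolve_smallClique_le_of_hubs (p : ℕ → unitInterval) {s n T m : ℕ} {L M : ℝ}
    (hp : ∀ r, s ≤ r → (p r : ℝ) ≤ 1 / 2) (hL : 0 < L) (hT : s + n ≤ T)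
    {G : Multigraph} (hG : Reachable s G) (hM : M ≤ (G.hubs m L).card) :
    evolve p s n (smallClique M) G ≤ m ^ 2 * Real.exp (-(L ^ 2 / (8 * T ^ 2))) ^ n := by
  have hdeg : ∀ v ∈ G.hubs m L, L ≤ G.degree v := fun v hv => (Finset.mem_filter.mp hv).2
  have hcard : (G.hubs m L).card ≤ m := by
    classical
    exact (Finset.card_filter_le _ _).trans (Finset.card_range m).le
  have hlt : ∀ v ∈ G.hubs m L, v < G.order := fun v hv => by
    by_contra h
    have h1 := hdeg v hv
    rw [G.degree_eq_zero_of_le (not_lt.mp h), Nat.cast_zero] at h1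
    linarith
  have hP : Persistent fun _ H => ∀ v ∈ G.hubs m L, v < H.order := fun t H h =>
    ⟨fun u v hv => ((persistent_lt_order v) t H (h v hv)).1 u,
      fun u w v hv => ((persistent_lt_order v) t H (h v hv)).2 u w⟩
  have key : ∀ H, (∀ v ∈ G.hubs m L, v < H.order) →
      smallClique M H ≤ ∑ e ∈ (G.hubs m L).offDiag, nonadj e.1 e.2 H := by
    intro H hH
    by_cases h : ∀ u ∈ G.hubs m L, ∀ v ∈ G.hubs m L, u ≠ v → s(u, v) ∈ H.edges
    · have h1 : ((G.hubs m L).card : ℝ) ≤ H.cliqueNumber := by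
        exact_mod_cast card_le_cliqueNumber hH h
      rw [smallClique, if_neg (by linarith)]
      exact Finset.sum_nonneg fun e _ => nonadj_nonneg _ _ _
    · push Not at h
      obtain ⟨u, hu, v, hv, huv, h⟩ := h
      refine (smallClique_le_one M H).trans ?_
      have h1 : nonadj u v H = 1 := if_neg h
      rw [← h1]
      exact Finset.single_le_sum (f := fun e : ℕ × ℕ => nonadj e.1 e.2 H)
        (fun e _ => nonadj_nonneg _ _ _)
        (Finset.mem_offDiag.mpr ⟨hu, hv, huv⟩ : (u, v) ∈ (G.hubs m L).offDiag)
  refine (evolve_mono p s hP hlt n fun H hH => key H hH).trans ?_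
  rw [evolve_sum]
  have hε : 0 ≤ Real.exp (-(L ^ 2 / (8 * (T : ℝ) ^ 2))) ^ n := by positivity
  calc _ ≤ ∑ e ∈ (G.hubs m L).offDiag, Real.exp (-(L ^ 2 / (8 * (T : ℝ) ^ 2))) ^ n := by
        refine Finset.sum_le_sum fun e he => ?_
        obtain ⟨h1, h2, -⟩ := Finset.mem_offDiag.mp he
        exact evolve_nonadj_le p hL hp hG (hdeg _ h1) (hdeg _ h2) n hT
    _ ≤ _ := by
        rw [Finset.sum_const, nsmul_eq_mul]
        refine mul_le_mul_of_nonneg_right ?_ hε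
        rw [Finset.offDiag_card, sq]
        exact_mod_cast (Nat.sub_le _ _).trans (Nat.mul_le_mul hcard hcard)

theorem sub_card_hubs_le {t m : ℕ} {L : ℝ} {G : Multigraph} (hG : Reachable t G)
    (hm : m ≤ G.order) :
    (m : ℝ) - (G.hubs m L).card ≤
      ∑ v ∈ Finset.range m, 2 * √L * birthWeight (G.degree v) := by
  classical
  have h1 := Finset.card_filter_add_card_filter_not (s := Finset.range m)
    (fun v => L ≤ (G.degree v : ℝ))
  rw [Finset.card_range] at h1
  have h2 : (m : ℝ) - (G.hubs m L).card =
      (((Finset.range m).filter fun v => ¬L ≤ (G.degree v : ℝ)).card : ℝ) := by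
    rw [sub_eq_iff_eq_add, add_comm]
    exact_mod_cast h1.symm
  rw [h2, Finset.card_filter]
  push_cast
  refine Finset.sum_le_sum fun v hv => ?_
  have hv' := Finset.mem_range.mp hv
  split_ifs with h
  · have := (birthWeight_pos (G.degree v)).le
    positivity
  · exact one_le_two_sqrt_mul_birthWeight (hG.one_le_degree v (by omega)) (not_le.mp h).le

/-- An upper bound for the probability of having no large clique. -/
theorem evolve_smallClique_le (p : ℕ → unitInterval) {s n k m T : ℕ} {q κ L M : ℝ}
    (hq : ∀ r < s, q ≤ p r) (hκ : 0 ≤ κ)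
    (hp : ∀ r, s ≤ r → 2 * κ ≤ (1 - p r) * (1 - 1 / (2 * ((s : ℝ) + 1))))
    (hp' : ∀ r, s ≤ r → (p r : ℝ) ≤ 1 / 2) (hL : 0 < L) (hT : s + n + k = T) (hm : 0 < m)
    (hM : 2 * M ≤ m) :
    evolve p 0 T (smallClique M) loop ≤
      2 ^ m * Real.exp (-(q / 2)) ^ s + 4 * √L * ((s + 1) / (s + n + 1) : ℝ) ^ κ +
        m ^ 2 * Real.exp (-(L ^ 2 / (8 * T ^ 2))) ^ k := by
  have hm0 : (0 : ℝ) < m := by exact_mod_cast hm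
  set ε := (m : ℝ) ^ 2 * Real.exp (-(L ^ 2 / (8 * T ^ 2))) ^ k
  have hε : 0 ≤ ε := by positivity
  set R := ((s + 1) / (s + n + 1) : ℝ) ^ κ
  have hR : 0 ≤ R := by positivity
  have key3 : ∀ H, Reachable (s + n) H ∧ (∀ v < m, v < H.order) →
      evolve p (s + n) k (smallClique M) H ≤
        2 / m * (∑ v ∈ Finset.range m, 2 * √L * birthWeight (H.degree v)) + ε := by
    intro H hH
    have hm' : m ≤ H.order := by
      by_contra h
      exact absurd (hH.2 H.order (not_le.mp h)) (lt_irrefl _)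
    -- With fewer than `M ≤ m/2` hubs, more than `m/2` of the first `m` vertices have small degree,
    -- and the weight sum times `2/m` is at least 1.
    by_cases h : M ≤ (H.hubs m L).card
    · have h1 := evolve_smallClique_le_of_hubs p (fun r hr => hp' r (by omega)) hL hT.le hH.1 h
      have h2 : 0 ≤ 2 / m * (∑ v ∈ Finset.range m, 2 * √L * birthWeight (H.degree v)) :=
        mul_nonneg (by positivity) (Finset.sum_nonneg fun v _ =>
          mul_nonneg (by positivity) (birthWeight_pos _).le)
      linarith
    · have h1 := evolve_le_one p (s + n) k (smallClique_le_one M) H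
      have h2 : 1 ≤ 2 / m * (∑ v ∈ Finset.range m, 2 * √L * birthWeight (H.degree v)) := by
        rw [div_mul_eq_mul_div, one_le_div hm0]
        linarith [sub_card_hubs_le (L := L) hH.1 hm', not_le.mp h]
      linarith
  have hP : Persistent fun _ H => ∀ v < m, v < H.order := fun t H h =>
    ⟨fun u v hv => ((persistent_lt_order v) t H (h v hv)).1 u,
      fun u w v hv => ((persistent_lt_order v) t H (h v hv)).2 u w⟩
  have key2 : ∀ G, Reachable s G → m ≤ G.order →
      evolve p s (n + k) (smallClique M) G ≤ 4 * √L * R + ε := by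
    intro G hG hm'
    rw [evolve_comp]
    refine (evolve_mono p s (persistent_reachable.and hP)
      ⟨hG, fun v hv => hv.trans_le hm'⟩ n key3).trans ?_
    rw [evolve_add, evolve_const, evolve_const_mul, evolve_sum]
    simp only [evolve_const_mul]
    refine add_le_add ?_ le_rfl
    calc _ ≤ 2 / m * ∑ v ∈ Finset.range m, 2 * √L * R := by
          refine mul_le_mul_of_nonneg_left (Finset.sum_le_sum fun v hv =>
            mul_le_mul_of_nonneg_left ?_ (by positivity)) (by positivity)
          exact evolve_birthWeight_le p hκ hp hG ((Finset.mem_range.mp hv).trans_le hm') n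
      _ = _ := by
          rw [Finset.sum_const, Finset.card_range, nsmul_eq_mul]
          field_simp
          ring
  have key1 : ∀ G, Reachable (0 + s) G → evolve p (0 + s) (n + k) (smallClique M) G ≤
      2 ^ m * (1 / 2 : ℝ) ^ G.order + (4 * √L * R + ε) := by
    intro G hG
    rw [zero_add] at hG ⊢
    -- Too few vertices at time `s` are paid for by `2^(m - order) ≥ 1`.
    by_cases h : m ≤ G.order
    · have : (0 : ℝ) ≤ 2 ^ m * (1 / 2 : ℝ) ^ G.order := by positivity
      linarith [key2 G hG h]
    · have h1 := evolve_le_one p s (n + k) (smallClique_le_one M) G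
      have h2 : (1 : ℝ) ≤ 2 ^ m * (1 / 2 : ℝ) ^ G.order := by
        rw [one_div, inv_pow, ← div_eq_mul_inv, one_le_div (by positivity)]
        exact pow_le_pow_right₀ (by norm_num) (not_le.mp h).le
      have h3 : 0 ≤ 4 * √L * R := by positivity
      linarith
  rw [← hT, add_assoc s, evolve_comp]
  refine (evolve_mono p 0 persistent_reachable Reachable.loop s key1).trans ?_
  rw [evolve_add, evolve_const, evolve_const_mul, add_assoc]
  gcongr
  exact evolve_half_pow_order_le p q s hq

end Multigraph

/-! ### Calculus of exponents -/

open Filter in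
/-- The sequence `X` is `t ^ (e + o(1))`. -/
def HasExponent (X : ℕ → ℝ) (e : ℝ) : Prop :=
  (∀ᶠ t in atTop, 0 < X t) ∧ Tendsto (fun t : ℕ => Real.log (X t) / Real.log t) atTop (𝓝 e)

namespace HasExponent

open Filter

theorem tendsto_log_natCast : Tendsto (fun t : ℕ => Real.log t) atTop atTop :=
  Real.tendsto_log_atTop.comp tendsto_natCast_atTop_atTop

variable {X Y : ℕ → ℝ} {e e' : ℝ}

theorem const {c : ℝ} (hc : 0 < c) : HasExponent (fun _ => c) 0 :=
  ⟨Eventually.of_forall fun _ => hc, tendsto_log_natCast.const_div_atTop _⟩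

theorem natCast_rpow (e : ℝ) : HasExponent (fun t => (t : ℝ) ^ e) e := by
  refine ⟨?_, tendsto_const_nhds.congr' ?_⟩
  · filter_upwards [eventually_gt_atTop 0] with t ht
    have : (0 : ℝ) < t := by exact_mod_cast ht
    positivity
  · filter_upwards [eventually_gt_atTop 1] with t ht
    have ht' : (1 : ℝ) < t := by exact_mod_cast ht
    rw [Real.log_rpow (by linarith), mul_div_cancel_right₀ _ (Real.log_pos ht').ne']

theorem natCast : HasExponent (fun t => (t : ℝ)) 1 := by
  simpa using natCast_rpow 1

theorem mul (hX : HasExponent X e) (hY : HasExponent Y e') :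
    HasExponent (fun t => X t * Y t) (e + e') := by
  refine ⟨?_, (hX.2.add hY.2).congr' ?_⟩
  · filter_upwards [hX.1, hY.1] with t h1 h2 using mul_pos h1 h2
  · filter_upwards [hX.1, hY.1] with t h1 h2
    rw [Real.log_mul h1.ne' h2.ne', add_div]

theorem rpow (hX : HasExponent X e) (κ : ℝ) : HasExponent (fun t => X t ^ κ) (κ * e) := by
  refine ⟨?_, (hX.2.const_mul κ).congr' ?_⟩
  · filter_upwards [hX.1] with t h1 using Real.rpow_pos_of_pos h1 _
  · filter_upwards [hX.1] with t h1
    rw [Real.log_rpow h1, mul_div_assoc]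

theorem pow_two (hX : HasExponent X e) : HasExponent (fun t => X t ^ 2) (2 * e) := by
  simpa using hX.rpow 2

theorem sqrt (hX : HasExponent X e) : HasExponent (fun t => √(X t)) (1 / 2 * e) := by
  simpa only [Real.sqrt_eq_rpow] using hX.rpow (1 / 2)

theorem inv (hX : HasExponent X e) : HasExponent (fun t => (X t)⁻¹) (-e) := by
  refine ⟨?_, hX.2.neg.congr' ?_⟩
  · filter_upwards [hX.1] with t h1 using inv_pos.mpr h1
  · filter_upwards with t
    rw [Real.log_inv, neg_div]

theorem div (hX : HasExponent X e) (hY : HasExponent Y e') :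
    HasExponent (fun t => X t / Y t) (e - e') := by
  simpa only [div_eq_mul_inv, sub_eq_add_neg] using hX.mul hY.inv

theorem log : HasExponent (fun t => Real.log t) 0 := by
  refine ⟨tendsto_log_natCast.eventually_gt_atTop 0, ?_⟩
  exact Real.isLittleO_log_id_atTop.tendsto_div_nhds_zero.comp tendsto_log_natCast

/-- Strictness of `e < e'` absorbs all constants and logarithms, which have exponent 0. -/
theorem eventually_le (hX : HasExponent X e) (hY : HasExponent Y e') (h : e < e') :
    ∀ᶠ t in atTop, X t ≤ Y t := by
  filter_upwards [hX.1, hY.1, hX.2.eventually_lt hY.2 h,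
    tendsto_log_natCast.eventually_gt_atTop 0] with t h1 h2 h3 h4
  rw [div_lt_div_iff_of_pos_right h4] at h3
  exact ((Real.log_lt_log_iff h1 h2).mp h3).le

/-- Constant factors do not change the exponent; rounding and adding 1 are covered by this. -/
theorem of_le_of_le (hX : HasExponent X e) {b c : ℝ} (hb : 0 < b) (hc : 0 < c)
    (h1 : ∀ᶠ t in atTop, b * X t ≤ Y t) (h2 : ∀ᶠ t in atTop, Y t ≤ c * X t) :
    HasExponent Y e := by
  have hl := (const hb).mul hX
  have hu := (const hc).mul hX
  have hY : ∀ᶠ t in atTop, 0 < Y t := by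
    filter_upwards [hl.1, h1] with t h3 h4 using h3.trans_le h4
  rw [zero_add] at hl hu
  refine ⟨hY, tendsto_of_tendsto_of_tendsto_of_le_of_le' hl.2 hu.2 ?_ ?_⟩
  · filter_upwards [hl.1, h1, tendsto_log_natCast.eventually_gt_atTop 0] with t h3 h4 h5
    exact div_le_div_of_nonneg_right (Real.log_le_log h3 h4) h5.le
  · filter_upwards [hY, h2, tendsto_log_natCast.eventually_gt_atTop 0] with t h3 h4 h5
    exact div_le_div_of_nonneg_right (Real.log_le_log h3 h4) h5.le

theorem eventually_one_le (hX : HasExponent X e) (h : 0 < e) : ∀ᶠ t in atTop, 1 ≤ X t :=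
  (const one_pos).eventually_le hX h

theorem floor (hX : HasExponent X e) (h : 0 < e) : HasExponent (fun t => (⌊X t⌋₊ : ℝ)) e := by
  refine hX.of_le_of_le (b := 1 / 2) (c := 1) (by norm_num) one_pos ?_ ?_
  · filter_upwards [hX.eventually_one_le h] with t ht
    have h1 := Nat.lt_floor_add_one (X t)
    have h2 : (1 : ℝ) ≤ ⌊X t⌋₊ := by exact_mod_cast Nat.one_le_floor_iff _ |>.mpr ht
    linarith
  · filter_upwards [hX.1] with t ht
    rw [one_mul]
    exact Nat.floor_le ht.le

theorem add_one (hX : HasExponent X e) (h : 0 < e) : HasExponent (fun t => X t + 1) e := by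
  refine hX.of_le_of_le (b := 1) (c := 2) one_pos two_pos ?_ ?_
  · filter_upwards with t
    linarith
  · filter_upwards [hX.eventually_one_le h] with t ht
    linarith

theorem ceil (hX : HasExponent X e) (h : 0 < e) : HasExponent (fun t => (⌈X t⌉₊ : ℝ)) e := by
  refine hX.of_le_of_le (b := 1) (c := 2) one_pos two_pos ?_ ?_
  · filter_upwards with t
    rw [one_mul]
    exact Nat.le_ceil _
  · filter_upwards [hX.eventually_one_le h] with t ht
    have := Nat.ceil_lt_add_one (zero_le_one.trans ht)
    linarith

theorem tendsto_atTop_of_pos (hX : HasExponent X e) (h : 0 < e) : Tendsto X atTop atTop := by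
  rw [tendsto_atTop]
  intro b
  filter_upwards [(const (lt_max_of_lt_right one_pos : 0 < max b 1)).eventually_le hX h] with t ht
    using (le_max_left _ _).trans ht

/-- Exponents can be composed. -/
theorem comp {N : ℕ → ℕ} (hX : HasExponent X e) (hN : HasExponent (fun t => (N t : ℝ)) e')
    (h : 0 < e') : HasExponent (fun t => X (N t)) (e * e') := by
  have hN' : Tendsto N atTop atTop :=
    tendsto_natCast_atTop_iff.mp (hN.tendsto_atTop_of_pos h)
  refine ⟨hN'.eventually hX.1, ((hX.2.comp hN').mul hN.2).congr' ?_⟩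
  filter_upwards [hN'.eventually (eventually_gt_atTop 1)] with t ht
  have : (0 : ℝ) < Real.log (N t) := Real.log_pos (by exact_mod_cast ht)
  simp only [Function.comp]
  field_simp

end HasExponent

/-! ### Regular variation and partial sums -/

section regularVariation

open Filter

/-- The increments of `log g(2^n)` tend to `ρ log 2` by regular variation with ratio 2; Cesàro
averaging gives the limit of the quotient. -/
theorem tendsto_log_two_pow_div {g : ℝ → ℝ} {ρ : ℝ} (hg : IsRegularlyVarying g ρ) :
    Tendsto (fun n : ℕ => Real.log (g (2 ^ n)) / n) atTop (𝓝 (ρ * Real.log 2)) := by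
  have h2 : Tendsto (fun n : ℕ => (2 : ℝ) ^ n) atTop atTop :=
    tendsto_pow_atTop_atTop_of_one_lt one_lt_two
  have h1 : Tendsto (fun n : ℕ => Real.log (g (2 ^ (n + 1))) - Real.log (g (2 ^ n))) atTop
      (𝓝 (ρ * Real.log 2)) := by
    rw [← Real.log_rpow two_pos]
    refine (((Real.continuousAt_log (by positivity)).tendsto.comp
      ((hg.2 2 two_pos).comp h2))).congr fun n => ?_
    simp only [Function.comp]
    rw [pow_succ', Real.log_div (hg.1 _ (by positivity)).ne' (hg.1 _ (by positivity)).ne']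
  have h3 := h1.cesaro
  simp only [Finset.sum_range_sub fun n => Real.log (g (2 ^ n))] at h3
  have h4 : Tendsto (fun n : ℕ => Real.log (g (2 ^ 0)) / n) atTop (𝓝 0) :=
    tendsto_natCast_atTop_atTop.const_div_atTop _
  have h5 := h3.add h4
  rw [add_zero] at h5
  refine h5.congr fun n => ?_
  ring

theorem tendsto_natLog_two_div_log :
    Tendsto (fun n : ℕ => (Nat.log 2 n : ℝ) / Real.log n) atTop (𝓝 (Real.log 2)⁻¹) := by
  have hlog := HasExponent.tendsto_log_natCast
  have h2 : 0 < Real.log 2 := Real.log_pos one_lt_two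
  have h0 : Tendsto (fun n : ℕ => (Real.log 2)⁻¹ - 1 / Real.log n) atTop
      (𝓝 ((Real.log 2)⁻¹ - 0)) := tendsto_const_nhds.sub (hlog.const_div_atTop _)
  rw [sub_zero] at h0
  refine tendsto_of_tendsto_of_tendsto_of_le_of_le' h0 tendsto_const_nhds ?_ ?_
  · filter_upwards [eventually_gt_atTop 1] with n hn
    have hn' : (0 : ℝ) < Real.log n := Real.log_pos (by exact_mod_cast hn)
    have h3 : (n : ℝ) < 2 ^ (Nat.log 2 n + 1) := by
      exact_mod_cast Nat.lt_pow_succ_log_self one_lt_two n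
    have h4 := Real.log_le_log (by positivity) h3.le
    rw [Real.log_pow] at h4
    push_cast at h4
    rw [inv_eq_one_div, div_sub_div _ _ h2.ne' hn'.ne', div_le_div_iff₀ (by positivity) hn']
    nlinarith
  · filter_upwards [eventually_gt_atTop 1] with n hn
    have hn' : (0 : ℝ) < Real.log n := Real.log_pos (by exact_mod_cast hn)
    have h3 : (2 : ℝ) ^ Nat.log 2 n ≤ n := by
      exact_mod_cast Nat.pow_log_le_self 2 (by omega)
    have h4 := Real.log_le_log (by positivity) h3
    rw [Real.log_pow] at h4
    rw [inv_eq_one_div, div_le_div_iff₀ hn' h2]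
    linarith

/-- A monotone regularly varying function of index `ρ` is `x ^ (ρ + o(1))`. -/
theorem IsRegularlyVarying.hasExponent {g : ℝ → ℝ} {ρ : ℝ} (hg : IsRegularlyVarying g ρ)
    (hmono : AntitoneOn g (Set.Ioi 0)) : HasExponent (fun n => g n) ρ := by
  have hpos : ∀ n : ℕ, 0 < n → (n : ℝ) ∈ Set.Ioi (0 : ℝ) := fun n hn => by
    simpa using hn
  refine ⟨?_, ?_⟩
  · filter_upwards [eventually_gt_atTop 0] with n hn using hg.1 _ (hpos n hn)
  have h2 : 0 < Real.log 2 := Real.log_pos one_lt_two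
  have hlog2 : Tendsto (fun n : ℕ => Nat.log 2 n) atTop atTop := by
    refine tendsto_atTop.mpr fun b => ?_
    filter_upwards [eventually_ge_atTop (2 ^ b)] with n hn
    exact Nat.le_log_of_pow_le one_lt_two hn
  have hG := tendsto_log_two_pow_div hg
  have hρ : ρ * Real.log 2 * (Real.log 2)⁻¹ = ρ := by field_simp
  have hup := (hG.comp hlog2).mul tendsto_natLog_two_div_log
  have hlow := (hG.comp ((tendsto_add_atTop_nat 1).comp hlog2)).mul
    (tendsto_natLog_two_div_log.add
      (HasExponent.tendsto_log_natCast.const_div_atTop (1 : ℝ)))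
  rw [add_zero] at hlow
  rw [hρ] at hup hlow
  -- Monotonicity places `g n` between its values at the two neighbouring powers of 2, so the dyadic
  -- limit suffices.
  refine tendsto_of_tendsto_of_tendsto_of_le_of_le' hlow hup ?_ ?_
  · filter_upwards [eventually_gt_atTop 1] with n hn
    have hn' : (0 : ℝ) < Real.log n := Real.log_pos (by exact_mod_cast hn)
    have h3 : (n : ℝ) ≤ 2 ^ (Nat.log 2 n + 1) := by
      exact_mod_cast (Nat.lt_pow_succ_log_self one_lt_two n).le
    have h4 := Real.log_le_log (hg.1 _ (by positivity))
      (hmono (hpos n (by omega)) (Set.mem_Ioi.mpr (by positivity)) h3)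
    simp only [Function.comp]
    push_cast
    rw [← add_div, ← mul_div_assoc, div_mul_cancel₀ _ (by positivity)]
    exact div_le_div_of_nonneg_right h4 hn'.le
  · filter_upwards [eventually_gt_atTop 1] with n hn
    have hn' : (0 : ℝ) < Real.log n := Real.log_pos (by exact_mod_cast hn)
    have h3 : (2 : ℝ) ^ Nat.log 2 n ≤ n := by
      exact_mod_cast Nat.pow_log_le_self 2 (by omega)
    have h4 := Real.log_le_log (hg.1 _ (hpos n (by omega)))
      (hmono (Set.mem_Ioi.mpr (by positivity)) (hpos n (by omega)) h3)
    have h5 : (Nat.log 2 n : ℝ) ≠ 0 := by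
      exact_mod_cast (Nat.log_pos one_lt_two hn).ne'
    simp only [Function.comp]
    rw [← mul_div_assoc, div_mul_cancel₀ _ h5]
    exact div_le_div_of_nonneg_right h4 hn'.le

/-- Bernoulli's inequality for the exponent `1 - θ ≤ 1` gives `s^(1-θ) ≤ (s+1)^(1-θ) -
(1-θ)(s+1)^(-θ)`, so the sum telescopes. -/
theorem sum_rpow_neg_le {θ : ℝ} (h0 : 0 ≤ θ) (h1 : θ < 1) (s : ℕ) :
    ∑ r ∈ Finset.range s, ((r : ℝ) + 1) ^ (-θ) ≤ (s : ℝ) ^ (1 - θ) / (1 - θ) := by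
  have hθ : 0 < 1 - θ := by linarith
  induction s with
  | zero => simp [Real.zero_rpow hθ.ne']
  | succ s ih =>
    rw [Finset.sum_range_succ]
    have hs : (0 : ℝ) < s + 1 := by positivity
    have h2 := rpow_one_add_le_one_add_mul_self (s := -(1 / ((s : ℝ) + 1))) (p := 1 - θ)
      (by rw [neg_le_neg_iff, div_le_one hs]; linarith [s.cast_nonneg (α := ℝ)]) hθ.le (by linarith)
    have h3 : (s : ℝ) = (s + 1) * (1 + -(1 / ((s : ℝ) + 1))) := by
      field_simp
      ring
    have h4 : (0 : ℝ) ≤ 1 + -(1 / ((s : ℝ) + 1)) := by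
      rw [show 1 + -(1 / ((s : ℝ) + 1)) = s / (s + 1) by field_simp; ring]
      positivity
    have h5 : (s : ℝ) ^ (1 - θ) ≤
        ((s : ℝ) + 1) ^ (1 - θ) - (1 - θ) * ((s : ℝ) + 1) ^ (-θ) := by
      rw [h3, Real.mul_rpow hs.le h4, ← h3]
      refine (mul_le_mul_of_nonneg_left h2 (by positivity)).trans (le_of_eq ?_)
      rw [sub_eq_add_neg 1 θ, Real.rpow_add hs, Real.rpow_one]
      field_simp
      ring
    push_cast
    calc _ ≤ (s : ℝ) ^ (1 - θ) / (1 - θ) + ((s : ℝ) + 1) ^ (-θ) := by gcongr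
      _ ≤ (((s : ℝ) + 1) ^ (1 - θ) - (1 - θ) * ((s : ℝ) + 1) ^ (-θ)) / (1 - θ) +
          ((s : ℝ) + 1) ^ (-θ) := by gcongr
      _ = _ := by
        field_simp
        ring

/-- Partial sums of a bounded sequence of exponent `-γ`. -/
theorem eventually_one_add_sum_le {X : ℕ → ℝ} {γ : ℝ} (hγ : γ < 1)
    (hX : HasExponent X (-γ)) (hX1 : ∀ n, X n ≤ 1) {ε : ℝ} (hε : 0 < ε) :
    ∀ᶠ s : ℕ in atTop,
      1 + ∑ r ∈ Finset.range s, X (r + 1) ≤ (s : ℝ) ^ (1 - γ + ε) := by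
  -- A `θ` slightly below `γ` makes `X n ≤ n^(-θ)` eventually. With `θ = 0` the bound `X ≤ 1`
  -- suffices.
  obtain ⟨θ, hθ0, hθγ, hθ1, hθ⟩ : ∃ θ, 0 ≤ θ ∧ θ < 1 ∧ γ - ε < θ ∧ (θ < γ ∨ θ = 0) := by
    by_cases h : 0 < γ
    · refine ⟨max 0 (γ - ε / 2), le_max_left _ _, max_lt one_pos (by linarith),
        lt_max_of_lt_right (by linarith), Or.inl (max_lt h (by linarith))⟩
    · exact ⟨0, le_rfl, one_pos, by linarith, Or.inr rfl⟩
  obtain ⟨C, hC, hXC⟩ : ∃ C : ℝ, 0 < C ∧ ∀ n : ℕ, X (n + 1) ≤ C * ((n : ℝ) + 1) ^ (-θ) := by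
    rcases hθ with h | rfl
    · obtain ⟨n₀, hn₀⟩ := eventually_atTop.mp
        (hX.eventually_le (HasExponent.natCast_rpow (-θ)) (by linarith))
      -- This factor covers the finitely many early terms through `X ≤ 1`.
      refine ⟨((n₀ : ℝ) + 1) ^ θ, by positivity, fun n => ?_⟩
      rcases le_or_gt n₀ (n + 1) with h' | h'
      · have h1 := hn₀ (n + 1) h'
        push_cast at h1
        refine h1.trans (le_mul_of_one_le_left (by positivity) ?_)
        exact Real.one_le_rpow (by linarith [n₀.cast_nonneg (α := ℝ)]) hθ0
      · refine (hX1 _).trans ?_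
        have h2 : (n : ℝ) + 1 ≤ n₀ + 1 := by
          have : (n : ℝ) + 1 ≤ n₀ := by exact_mod_cast h'.le
          linarith
        rw [Real.rpow_neg (by positivity), ← div_eq_mul_inv, one_le_div (by positivity)]
        gcongr
    · exact ⟨1, one_pos, fun n => by simpa using hX1 (n + 1)⟩
  have h1θ : 0 < 1 - θ := by linarith
  have hD := (HasExponent.const (c := 1 + C / (1 - θ)) (by positivity)).mul
    (HasExponent.natCast_rpow (1 - θ))
  filter_upwards [hD.eventually_le (HasExponent.natCast_rpow (1 - γ + ε)) (by linarith),
    (HasExponent.natCast_rpow (1 - θ)).eventually_one_le h1θ] with s h1 h2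
  refine le_trans ?_ h1
  have h3 : ∑ r ∈ Finset.range s, X (r + 1) ≤ C * ((s : ℝ) ^ (1 - θ) / (1 - θ)) := by
    refine (Finset.sum_le_sum fun r _ => hXC r).trans ?_
    rw [← Finset.mul_sum]
    exact mul_le_mul_of_nonneg_left (sum_rpow_neg_le hθ0 hθγ s) hC.le
  calc _ ≤ (s : ℝ) ^ (1 - θ) + C * ((s : ℝ) ^ (1 - θ) / (1 - θ)) := add_le_add h2 h3
    _ = _ := by ring

end regularVariation

/-! ### Choice of parameters -/

namespace Multigraph

open Filter

theorem hasExponent_const_div_log {c : ℝ} (hc : 0 < c) :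
    HasExponent (fun t => c / Real.log t) 0 := by
  simpa using (HasExponent.const hc).div HasExponent.log

/-- Take `s = ⌊√t⌋` and `a = 1 - γ`. The exponents `a/2 + aδ/8` of the bound for the mean order at
time `s`, `a/2 + aδ/4` of `m` and `a/2 + aδ/2` of `B` increase strictly; the squared threshold `B²`
beats the late edges, of exponent `a`. -/
theorem eventually_evolve_largeClique_le {δ γ : ℝ} (hδ : δ ∈ Set.Ioo (0 : ℝ) 1)
    (hγ : γ ∈ Set.Ico (0 : ℝ) 1) {f : ℝ → unitInterval}
    (hf : DecreasesToZero (fun x => (f x : ℝ)))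
    (hrv : IsRegularlyVarying (fun x => (f x : ℝ)) (-γ)) :
    ∀ᶠ t : ℕ in atTop, evolve (fun r => f ((r : ℝ) + 1)) 0 t
      (largeClique ((t : ℝ) ^ ((1 - γ) * (1 + δ) / 2))) loop ≤ (1 / 2) / Real.log t := by
  obtain ⟨hδ0, hδ1⟩ := hδ
  obtain ⟨hγ0, hγ1⟩ := hγ
  have ha : 0 < 1 - γ := by linarith
  have haδ : 0 < (1 - γ) * δ := by positivity
  have hX : HasExponent (fun n => (f n : ℝ)) (-γ) := hrv.hasExponent hf.1
  have hs0 := HasExponent.natCast_rpow (1 / 2)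
  have hs := hs0.floor (by norm_num)
  have hs1 := hs.add_one (by norm_num)
  have hφ : HasExponent (fun t : ℕ => (f ((⌊(t : ℝ) ^ (1 / 2 : ℝ)⌋₊ : ℝ) + 1) : ℝ))
      (-γ * (1 / 2)) := by
    have h := hX.comp (N := fun t => ⌊(t : ℝ) ^ (1 / 2 : ℝ)⌋₊ + 1) (e' := 1 / 2)
      (by simpa using hs1) (by norm_num)
    simpa using h
  have hm := (HasExponent.natCast_rpow ((1 - γ) / 2 + (1 - γ) * δ / 4)).ceil (by positivity)
  have hB := HasExponent.natCast_rpow ((1 - γ) * (1 + δ) / 2)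
  have hΛ := (HasExponent.const (c := 2) two_pos).mul HasExponent.log
  have hm2 : HasExponent (fun t => 2 * ((⌈(t : ℝ) ^ ((1 - γ) / 2 + (1 - γ) * δ / 4)⌉₊ : ℝ) + 1 + 1))
      (0 + ((1 - γ) / 2 + (1 - γ) * δ / 4)) :=
    (HasExponent.const two_pos).mul ((hm.add_one (by positivity)).add_one (by positivity))
  have hsum := (hs.tendsto_atTop_of_pos (by norm_num)
    |> tendsto_natCast_atTop_iff.mp).eventually
    (eventually_one_add_sum_le hγ1 hX (fun n => (f n).2.2) (ε := (1 - γ) * δ / 4) (by positivity))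
  have herr1 := ((hs.rpow (1 - γ + (1 - γ) * δ / 4)).div hm).eventually_le
    (hasExponent_const_div_log (c := 1 / 4) (by norm_num)) (by nlinarith)
  -- The 48 is `12 · 4`, from replacing `B - m` by `B/2`. The factor `Λ = 2 log t` suffices because
  -- `t + 1 ≤ t²`.
  have herr2 := (((HasExponent.const (c := 48) (by norm_num)).mul HasExponent.natCast).mul
    (hφ.mul hΛ).pow_two).div hB.pow_two |>.eventually_le
    (hasExponent_const_div_log (c := 1 / 4) (by norm_num)) (by nlinarith)
  filter_upwards [hsum, herr1, herr2, (hφ.mul hs1).eventually_one_le (by linarith),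
    hm2.eventually_le hB (by nlinarith), hB.1, hm.1,
    HasExponent.tendsto_log_natCast.eventually_ge_atTop 1, eventually_ge_atTop 2,
    hs0.eventually_le HasExponent.natCast (by norm_num)]
    with t hsum herr1 herr2 h1 h2 h3 h4 h5 h6 h7
  set s := ⌊(t : ℝ) ^ (1 / 2 : ℝ)⌋₊
  set m := ⌈(t : ℝ) ^ ((1 - γ) / 2 + (1 - γ) * δ / 4)⌉₊
  set B := (t : ℝ) ^ ((1 - γ) * (1 + δ) / 2)
  have hst : s ≤ t := by
    have : (s : ℝ) ≤ t := (Nat.floor_le (by positivity)).trans h7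
    exact_mod_cast this
  have ht : s + (t - s) = t := by omega
  have ht2 : (2 : ℝ) ≤ t := by exact_mod_cast h6
  have key := evolve_largeClique_le (fun r => f ((r : ℝ) + 1)) (s := s) (n := t - s) (m := m)
    (φ := f ((s : ℝ) + 1)) (Λ := 2 * Real.log t) (B := B)
    (fun r hr => hf.1 (Set.mem_Ioi.mpr (by positivity)) (Set.mem_Ioi.mpr (by positivity))
      (by have : (s : ℝ) ≤ r := by exact_mod_cast hr
          linarith)) h1 (by linarith)
    (by
      have e : ((s : ℝ) + (t - s : ℕ) + 1) = t + 1 := by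
        rw [Nat.cast_sub hst]
        ring
      rw [e, ← Nat.cast_two, ← Real.log_pow]
      refine Real.log_le_log (by positivity) ?_
      nlinarith)
    (by exact_mod_cast h4) (by linarith)
  rw [ht] at key
  refine key.trans ?_
  have e1 : (1 + ∑ r ∈ Finset.range s, (f ((r : ℝ) + 1) : ℝ)) / m ≤ 1 / 4 / Real.log t := by
    refine le_trans (div_le_div_of_nonneg_right ?_ h4.le) herr1
    simpa using hsum
  have e2 : 12 * ((t - s : ℕ) : ℝ) * (f ((s : ℝ) + 1) * (2 * Real.log t)) ^ 2 / (B - m) ^ 2 ≤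
      1 / 4 / Real.log t := by
    refine le_trans ?_ herr2
    have hB2 : B / 2 ≤ B - m := by linarith
    calc _ ≤ 12 * (t : ℝ) * (f ((s : ℝ) + 1) * (2 * Real.log t)) ^ 2 / (B / 2) ^ 2 := by
          gcongr
          exact Nat.sub_le _ _
      _ = _ := by
          field_simp
          ring
  calc _ ≤ 1 / 4 / Real.log t + 1 / 4 / Real.log t := add_le_add e1 e2
    _ = _ := by ring

/-- With `ε = δ/16`, take `s = ⌊t^c⌋` for `c = 1/2 - 3ε`, `L = t^(1/2+ε)` and `κ = (1-ε)/2`. Then `c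
> (1-δ)/2` leaves room for `m` vertices at time `s`; degrees grow until `t/2` and hubs are joined
afterwards. -/
theorem eventually_evolve_smallClique_le {δ γ : ℝ} (hδ : δ ∈ Set.Ioo (0 : ℝ) 1)
    (hγ : γ ∈ Set.Ico (0 : ℝ) 1) {f : ℝ → unitInterval}
    (hf : DecreasesToZero (fun x => (f x : ℝ)))
    (hrv : IsRegularlyVarying (fun x => (f x : ℝ)) (-γ)) :
    ∀ᶠ t : ℕ in atTop, evolve (fun r => f ((r : ℝ) + 1)) 0 t
      (smallClique ((t : ℝ) ^ ((1 - γ) * (1 - δ) / 2))) loop ≤ (1 / 2) / Real.log t := by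
  obtain ⟨hδ0, hδ1⟩ := hδ
  obtain ⟨hγ0, hγ1⟩ := hγ
  have ha : 0 < 1 - γ := by linarith
  have ha1 : 0 < (1 - γ) * (1 - δ) := mul_pos ha (by linarith)
  have haδ : 0 < (1 - γ) * δ := by positivity
  set ε := δ / 16 with hε
  set c := 1 / 2 - 3 * ε with hc
  have hε0 : 0 < ε := by positivity
  have hc0 : 0 < c := by linarith
  have hX : HasExponent (fun n => (f n : ℝ)) (-γ) := hrv.hasExponent hf.1
  have hs0 := HasExponent.natCast_rpow c
  have hs := hs0.floor hc0
  have hs1 := hs.add_one hc0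
  have hsN : Tendsto (fun t : ℕ => ⌊(t : ℝ) ^ c⌋₊) atTop atTop :=
    tendsto_natCast_atTop_iff.mp (hs.tendsto_atTop_of_pos hc0)
  have hq := hX.comp (N := fun t => ⌊(t : ℝ) ^ c⌋₊) hs hc0
  have hm := ((HasExponent.const (c := 2) two_pos).mul
    (HasExponent.natCast_rpow ((1 - γ) * (1 - δ) / 2))).ceil (by linarith)
  have hL := HasExponent.natCast_rpow (1 / 2 + ε)
  have hη : ∀ᶠ t : ℕ in atTop, 1 - ε ≤ (1 - (f ((⌊(t : ℝ) ^ c⌋₊ : ℝ) + 1) : ℝ)) *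
      (1 - 1 / (2 * ((⌊(t : ℝ) ^ c⌋₊ : ℝ) + 1))) := by
    have h1 : Tendsto (fun t : ℕ => (⌊(t : ℝ) ^ c⌋₊ : ℝ) + 1) atTop atTop :=
      hs1.tendsto_atTop_of_pos hc0
    have h2 := (tendsto_const_nhds (x := (1 : ℝ))).sub (hf.2.comp h1)
    have h3 := (tendsto_const_nhds (x := (1 : ℝ))).sub
      ((h1.const_mul_atTop two_pos).const_div_atTop 1)
    have h4 := h2.mul h3
    exact h4.eventually_const_le (by linarith)
  have hhalf : ∀ᶠ t : ℕ in atTop, (f ((⌊(t : ℝ) ^ c⌋₊ : ℝ) + 1) : ℝ) ≤ 1 / 2 :=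
    (hf.2.comp (hs1.tendsto_atTop_of_pos hc0)).eventually_le_const (by norm_num)
  -- Once `4m ≤ s f(s)`, the Chernoff term is at most `exp(-m) ≤ 1/m`.
  have herr1 := hm.inv.eventually_le
    (hasExponent_const_div_log (c := 1 / 6) (by norm_num)) (by linarith)
  have hord := ((HasExponent.const (c := 4) (by norm_num)).mul hm).eventually_le (hq.mul hs)
    (by nlinarith)
  -- The exponent is `(1/2+ε)/2 - (1/2+3ε)(1-ε)/2 = -3ε/4 + 3ε²/2`, negative since `ε < 1/2`.
  have herr2 := (((HasExponent.const (c := 4) (by norm_num)).mul hL.sqrt).mul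
    ((hs1.div ((HasExponent.const (c := 1 / 2) (by norm_num)).mul
      HasExponent.natCast)).rpow ((1 - ε) / 2))).eventually_le
    (hasExponent_const_div_log (c := 1 / 6) (by norm_num)) (by nlinarith)
  -- `L²/t` has exponent `2ε`, so the nonadjacency probability `exp(-L²/(16t))` is at most `t^(-3)`,
  -- which beats the `m²` pairs.
  have hexp := ((HasExponent.const (c := 3) (by norm_num)).mul HasExponent.log).eventually_le
    ((hL.pow_two.div HasExponent.natCast).div (HasExponent.const (c := 16) (by norm_num)))
    (by linarith)
  have herr3 := (hm.pow_two.mul (HasExponent.natCast_rpow (-3))).eventually_le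
    (hasExponent_const_div_log (c := 1 / 6) (by norm_num)) (by nlinarith)
  filter_upwards [hη, hhalf, herr1, hord, herr2, hexp, herr3, hm.1, hL.1, hs.1,
    eventually_ge_atTop 2,
    hs1.eventually_le ((HasExponent.const (c := 1 / 2) (by norm_num)).mul HasExponent.natCast)
      (by linarith)]
    with t hη hhalf herr1 hord herr2 hexp herr3 hm0 hL0 hs0 ht hst
  set s := ⌊(t : ℝ) ^ c⌋₊
  set M := (t : ℝ) ^ ((1 - γ) * (1 - δ) / 2)
  set m := ⌈2 * M⌉₊
  set L := (t : ℝ) ^ (1 / 2 + ε)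
  have ht0 : (0 : ℝ) < t := by
    have : 0 < t := by omega
    exact_mod_cast this
  have hs0' : 0 < s := by exact_mod_cast hs0
  have hst' : s ≤ t / 2 := by
    rw [Nat.le_div_iff_mul_le two_pos]
    have : (s : ℝ) * 2 ≤ t := by linarith
    exact_mod_cast this
  have hdecr : ∀ r, s ≤ r → (f ((r : ℝ) + 1) : ℝ) ≤ f ((s : ℝ) + 1) := fun r hr =>
    hf.1 (Set.mem_Ioi.mpr (by positivity)) (Set.mem_Ioi.mpr (by positivity))
      (by have : (s : ℝ) ≤ r := by exact_mod_cast hr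
          linarith)
  have key := evolve_smallClique_le (fun r => f ((r : ℝ) + 1)) (s := s) (n := t / 2 - s)
    (k := t - t / 2) (m := m) (T := t) (q := f (s : ℝ)) (κ := (1 - ε) / 2) (L := L) (M := M)
    (fun r hr => hf.1 (Set.mem_Ioi.mpr (by positivity)) (Set.mem_Ioi.mpr hs0)
      (by exact_mod_cast hr)) (by linarith)
    (fun r hr => by
      have h1 : (0 : ℝ) ≤ 1 - 1 / (2 * ((s : ℝ) + 1)) := by
        rw [sub_nonneg, div_le_one (by positivity)]
        linarith
      have h2 := hdecr r hr
      calc _ = 1 - ε := by ring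
        _ ≤ _ := hη
        _ ≤ _ := mul_le_mul_of_nonneg_right (by linarith) h1)
    (fun r hr => (hdecr r hr).trans hhalf) hL0 (by omega) (by exact_mod_cast hm0)
    (Nat.le_ceil _)
  refine key.trans ?_
  have e1 : 2 ^ m * Real.exp (-((f (s : ℝ) : ℝ) / 2)) ^ s ≤ 1 / 6 / Real.log t := by
    refine le_trans ?_ herr1
    have h2 : (2 : ℝ) ^ m ≤ Real.exp m := by
      rw [← Real.exp_one_pow]
      gcongr
      linarith [Real.add_one_le_exp 1]
    calc _ ≤ Real.exp m * Real.exp (-((f (s : ℝ) : ℝ) / 2)) ^ s := by gcongr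
      _ = Real.exp (m - f (s : ℝ) * s / 2) := by
        rw [← Real.exp_nat_mul, ← Real.exp_add]
        congr 1
        ring
      _ ≤ Real.exp (-m) := Real.exp_le_exp.mpr (by linarith)
      _ ≤ _ := by
        rw [Real.exp_neg]
        gcongr
        linarith [Real.add_one_le_exp (m : ℝ)]
  have e2 : 4 * √L * (((s : ℝ) + 1) / (s + (t / 2 - s : ℕ) + 1)) ^ ((1 - ε) / 2) ≤
      1 / 6 / Real.log t := by
    refine le_trans ?_ herr2
    have h1 : 1 / 2 * (t : ℝ) ≤ s + (t / 2 - s : ℕ) + 1 := by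
      have : t ≤ 2 * (s + (t / 2 - s) + 1) := by omega
      have : (t : ℝ) ≤ 2 * (s + (t / 2 - s : ℕ) + 1) := by exact_mod_cast this
      linarith
    have : 0 ≤ (1 - ε) / 2 := by linarith
    gcongr
  have e3 : (m : ℝ) ^ 2 * Real.exp (-(L ^ 2 / (8 * (t : ℝ) ^ 2))) ^ (t - t / 2) ≤
      1 / 6 / Real.log t := by
    refine le_trans (mul_le_mul_of_nonneg_left ?_ (by positivity)) herr3
    rw [← Real.exp_nat_mul, Real.rpow_def_of_pos ht0, Real.exp_le_exp]
    have h1 : (t : ℝ) / 2 ≤ (t - t / 2 : ℕ) := by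
      have : t ≤ 2 * (t - t / 2) := by omega
      have : (t : ℝ) ≤ 2 * (t - t / 2 : ℕ) := by exact_mod_cast this
      linarith
    have h2 : L ^ 2 / t / 16 ≤ ((t - t / 2 : ℕ) : ℝ) * (L ^ 2 / (8 * (t : ℝ) ^ 2)) := by
      calc _ = (t : ℝ) / 2 * (L ^ 2 / (8 * (t : ℝ) ^ 2)) := by
            field_simp
            ring
        _ ≤ _ := by gcongr
    linarith
  calc _ ≤ 1 / 6 / Real.log t + 1 / 6 / Real.log t + 1 / 6 / Real.log t :=
        add_le_add (add_le_add e1 e2) e3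
    _ = _ := by ring

end Multigraph

/-! ### Conclusion -/

theorem theorem2 (δ : ℝ) (hδ : δ ∈ Set.Ioo (0 : ℝ) 1) :
    ∃ c₁ c₂ c₃ : ℝ, 0 < c₁ ∧ 0 < c₂ ∧ 0 < c₃ ∧
      ∀ (γ : ℝ) (_hγ : γ ∈ Set.Ico (0 : ℝ) 1) (f : ℝ → unitInterval)
        (_hf : DecreasesToZero (fun x => (f x : ℝ)))
        (_hrv : IsRegularlyVarying (fun x => (f x : ℝ)) (-γ)),
        -- with constants that depend on `δ` only, for all large `t`
        (∃ t₀ : ℕ, ∀ t : ℕ, t₀ ≤ t →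
          1 - c₃ / Real.log t ≤
            probCliqueBetween f t (c₁ * (t : ℝ) ^ ((1 - γ) * (1 - δ) / 2))
              (c₂ * (t : ℝ) ^ ((1 - γ) * (1 + δ) / 2))) ∧
        -- for all `t ≥ 2`, with the constant in the probability depending on `δ` and `f`
        (∃ C₃ : ℝ, 0 < C₃ ∧ ∀ t : ℕ, 2 ≤ t →
          1 - C₃ / Real.log t ≤
            probCliqueBetween f t (c₁ * (t : ℝ) ^ ((1 - γ) * (1 - δ) / 2))
              (c₂ * (t : ℝ) ^ ((1 - γ) * (1 + δ) / 2))) := by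
  refine ⟨1, 1, 1, one_pos, one_pos, one_pos, fun γ hγ f hf hrv => ?_⟩
  have hlarge : ∃ t₀ : ℕ, ∀ t : ℕ, t₀ ≤ t →
      1 - 1 / Real.log t ≤
        probCliqueBetween f t (1 * (t : ℝ) ^ ((1 - γ) * (1 - δ) / 2))
          (1 * (t : ℝ) ^ ((1 - γ) * (1 + δ) / 2)) := by
    refine Filter.eventually_atTop.mp ?_
    filter_upwards [Multigraph.eventually_evolve_smallClique_le hδ hγ hf hrv,
      Multigraph.eventually_evolve_largeClique_le hδ hγ hf hrv] with t h1 h2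
    rw [one_mul, one_mul]
    refine le_trans ?_ (Multigraph.probCliqueBetween_ge f t _ _)
    have h3 : 1 / Real.log t = 1 / 2 / Real.log t + 1 / 2 / Real.log t := by ring
    linarith
  refine ⟨hlarge, ?_⟩
  obtain ⟨t₀, ht₀⟩ := hlarge
  -- For `t ≤ t₀` this constant exceeds `log t`, so the lower bound is not positive and the claim is
  -- trivial.
  refine ⟨1 + Real.log (t₀ + 1), add_pos_of_pos_of_nonneg one_pos (Real.log_nonneg (by simp)),
    fun t ht => ?_⟩
  have hlog : 0 < Real.log t := Real.log_pos (by exact_mod_cast ht)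
  have hlog₀ : 0 ≤ Real.log ((t₀ : ℝ) + 1) := Real.log_nonneg (by simp)
  rcases le_total t₀ t with h | h
  · refine le_trans ?_ (ht₀ t h)
    gcongr
    linarith
  · refine le_trans ?_ MeasureTheory.measureReal_nonneg
    rw [sub_nonpos, one_le_div hlog]
    have h1 : (t : ℝ) ≤ t₀ + 1 := by
      have : (t : ℝ) ≤ t₀ := by exact_mod_cast h
      linarith
    linarith [Real.log_le_log (by positivity) h1]
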